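/- **Setting.** A set-operad $\mathcal P$ is a functor from finite sets and bijections to sets with a unit in $\mathcal P(\{*\})$ and natural, associative, unital composition maps $\mathcal P(I)\times\prod_{i\in I}\mathcal P(J_i)\to\mathcal P(\coprod_{i\in I}J_i)$, $(x,(y_i))\mapsto x\circ(y_i)$. It is *augmented* if $\mathcal P(\emptyset)=\emptyset$ and $\mathcal P$ of every singleton is a singleton, and *basic* if every map $x\mapsto x\circ(y_i)$ is injective. An element $x$ of $\Pi_{\mathcal P}(I)$ is a partition $\pi_x$ of $I$ together with an element $x_J\in\mathcal P(J)$ for each part $J$; it is ordered by $x\le y$ iff $y=\theta\circ x$ for some $\theta\in\Pi_{\mathcal P}(\pi_x)$, where $\theta\circ x$ is composed part by part. Its least element is $\widehat 0$, the partition into singletons with the unit on each part. Let $\mathtt A_{\mathcal P}=\coprod_n\mathcal P(n)_{\mathfrak S_n}$ be the set of coinvariants, $\langle x\rangle$ the coinvariant of $x$, $\varepsilon$ the coinvariant of the unit, $r(\alpha)\in\mathcal P(n)$ a representative of $\alpha$, $\mathrm{Aut}(\alpha)\subseteq\mathfrak S_n$ its stabilizer, and $P_\alpha=[\widehat 0,r(\alpha)]\subseteq\Pi_{\mathcal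 P}(n)$, where $r(\alpha)$ is viewed as an element with one part. *The algebra $H_{\mathcal P}$.* It is the $\mathbb Q$-vector space with basis $\mathsf F_{[Q]}$ indexed by the isomorphism classes of finite products $Q$ of posets $P_\alpha$, with $\mathsf F_{[Q]}\mathsf F_{[Q']}=\mathsf F_{[Q\times Q']}$, $\Delta\mathsf F_{[Q]}=\sum_{x\in Q}\mathsf F_{[\widehat 0,x]}\otimes\mathsf F_{[x,\widehat 1]}$, and $\epsilon(\mathsf F_{[Q]})=1$ if $Q$ has one element and $0$ otherwise. Write $\mathsf F_{[\alpha]}=\mathsf F_{[P_\alpha]}$. *The group $G_{\mathcal P}$.* For a commutative $\mathbb Q$-algebra $R$, $G_{\mathcal P}(R)$ is the set of formal series $g=\sum_{\alpha\in\mathtt A_{\mathcal P}}g_\alpha\,\alpha$ with $g_\alpha\in R$ and $g_\varepsilon=1$, with product $$g\times h=\sum_{a}\ \sum_{b_1,\dots,b_m}g_a\,h_{b_1}\cdots h_{b_m}\,\langle r(a)\circ(r(b_1),\dots,r(b_m))\rangle\qquad(a\in\mathcal P(m)_{\mathfrak S_m},\ b_i\in\mathtt A_{\mathcal P}).$$ The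 algebra $\mathbb Q[G_{\mathcal P}]$ is the free commutative $\mathbb Q$-algebra on the coordinate functions $\mathsf G_\alpha$, $\alpha\ne\varepsilon$ (and $\mathsf G_\varepsilon=1$), with the coproduct $\Delta\mathsf G_\alpha=\sum\mathsf G_{b_1}\cdots\mathsf G_{b_m}\otimes\mathsf G_a$ over all $a,b_1,\dots,b_m$ with $\langle r(a)\circ(r(b_1),\dots,r(b_m))\rangle=\alpha$ (that is, $\Delta f(h\otimes g)=f(g\times h)$), and with counit the evaluation at the neutral element, $\epsilon(\mathsf G_\alpha)=0$ for $\alpha\neq\varepsilon$. **Theorem.** Let $\mathcal P$ be a basic augmented set-operad such that all intervals $P_\alpha$ are finite (for example, such that all sets $\mathcal P(n)$ are finite). Then: 1. The finite products of the posets $P_\alpha$ are finite posets with least element $\widehat0$ and greatest element $\widehat1$, and up to isomorphism they are closed under initial intervals $[\widehat 0,x]$ and final intervals $[x,\widehat 1]$. With the structure maps above, $\mathbb Q[G_{\mathcal P}]$ and $H_{\mathcal P}$ are Hopf algebras. 2. There is a surjective morphism of Hopf algebras $\rho:\mathbb Q[G_{\mathcal P}]\to H_{\mathcal P}$ with $\rho(\mathsf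 G_\alpha)=\mathsf F_{[\alpha]}/\#\mathrm{Aut}(\alpha)$ for all $\alpha\in\mathtt A_{\mathcal P}$. 3. In terms of groups: for every commutative $\mathbb Q$-algebra $R$, $G_{\mathcal P}(R)$ is a group under $\times$; the map $\varphi\mapsto\sum_\alpha\varphi(\mathsf G_\alpha)\,\alpha$ is an isomorphism from the opposite of the convolution group of algebra morphisms $\mathbb Q[G_{\mathcal P}]\to R$ onto $G_{\mathcal P}(R)$; and $\varphi\mapsto\sum_\alpha\frac{\varphi(\mathsf F_{[\alpha]})}{\#\mathrm{Aut}(\alpha)}\,\alpha$ is an isomorphism from the opposite of the convolution group $(\operatorname{Spec}H_{\mathcal P})(R)$ of algebra morphisms $H_{\mathcal P}\to R$ onto a subgroup of $G_{\mathcal P}(R)$. (With the conventions above for $\Delta$ and $\times$, the convolution $\varphi*\psi$ corresponds to the product of the series of $\psi$ with the series of $\varphi$.) -/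

import Mathlib

open scoped TensorProduct

universe u v

/-! ### Set-operads -/

/-- A set-operad: a species `obj` (a functor from finite sets and bijections to sets, `map` being the
relabelling), a unit, and composition maps `P(I) × ∏ i, P(J i) → P(Σ i, J i)` that are natural,
associative and unital. Finite sets are the finite types in `Type`. -/
structure SetOperad where
  obj : (I : Type) → [Finite I] → Type u
  map : ∀ {I J : Type} [Finite I] [Finite J], (I ≃ J) → obj I → obj J
  map_refl : ∀ {I : Type} [Finite I] (x : obj I), map (Equiv.refl I) x = x
  map_trans : ∀ {I J K : Type} [Finite I] [Finite J] [Finite K] (e : I ≃ J) (f : J ≃ K)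
    (x : obj I), map (e.trans f) x = map f (map e x)
  unit : obj Unit
  comp : ∀ {I : Type} [Finite I] {J : I → Type} [∀ i, Finite (J i)],
    obj I → (∀ i, obj (J i)) → obj (Σ i, J i)
  comp_map_left : ∀ {I I' : Type} [Finite I] [Finite I'] {J : I' → Type} [∀ i, Finite (J i)]
    (e : I ≃ I') (x : obj I) (y : ∀ i, obj (J i)),
    comp (map e x) y = map (Equiv.sigmaCongrLeft e) (comp x fun i => y (e i))
  comp_map_right : ∀ {I : Type} [Finite I] {J K : I → Type} [∀ i, Finite (J i)]
    [∀ i, Finite (K i)] (e : ∀ i, J i ≃ K i) (x : obj I) (y : ∀ i, obj (J i)),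
    (comp x fun i => map (e i) (y i)) = map (Equiv.sigmaCongrRight e) (comp x y)
  assoc : ∀ {I : Type} [Finite I] {J : I → Type} [∀ i, Finite (J i)]
    {K : ∀ i, J i → Type} [∀ i j, Finite (K i j)]
    (x : obj I) (y : ∀ i, obj (J i)) (z : ∀ i j, obj (K i j)),
    map (Equiv.sigmaAssoc K) (comp (comp x y) fun p : Σ i, J i => z p.1 p.2) =
      comp x fun i => comp (y i) (z i)
  unit_comp : ∀ {I : Type} [Finite I] (x : obj I),
    map ((Equiv.sigmaEquivProd Unit I).trans (Equiv.punitProd I)) (comp unit fun _ => x) = x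
  comp_unit : ∀ {I : Type} [Finite I] (x : obj I),
    map (Equiv.sigmaPUnit I) (comp x fun _ => unit) = x

/-! ### Isomorphism classes of posets and incidence Hopf algebras -/

/-- Two partially ordered types are identified when they are order isomorphic. -/
instance posetSetoid : Setoid PartOrd.{u} where
  r Q Q' := Nonempty (Q ≃o Q')
  iseqv := ⟨fun _ => ⟨OrderIso.refl _⟩, fun ⟨e⟩ => ⟨e.symm⟩, fun ⟨e⟩ ⟨f⟩ => ⟨e.trans f⟩⟩

/-- Isomorphism classes `[Q]` of posets. -/
def PosetClass : Type (u + 1) := Quotient posetSetoid.{u}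

namespace PosetClass

/-- The isomorphism class of a poset. -/
def mk (Q : Type u) [PartialOrder Q] : PosetClass.{u} := Quotient.mk _ (PartOrd.of Q)

theorem mk_eq_mk {Q Q' : Type u} [PartialOrder Q] [PartialOrder Q'] (e : Q ≃o Q') :
    mk Q = mk Q' := Quotient.sound ⟨e⟩

theorem ind_mk {p : PosetClass.{u} → Prop} (h : ∀ (Q : Type u) [PartialOrder Q], p (mk Q))
    (c : PosetClass.{u}) : p c := by
  induction c using Quotient.inductionOn with
  | h Q => exact h Q

/-- The product of classes is the class of the product poset, with the componentwise order; the
neutral element is the class of the one-point poset. -/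
instance : CommMonoid PosetClass.{u} where
  one := mk PUnit
  mul := Quotient.map₂ (fun Q Q' => PartOrd.of (Q × Q'))
    (fun _ _ ⟨e⟩ _ _ ⟨f⟩ => ⟨⟨e.toEquiv.prodCongr f.toEquiv, by simp [Prod.le_def]⟩⟩)
  mul_assoc := by
    intro a b c
    induction a using ind_mk with | h Q =>
    induction b using ind_mk with | h Q' =>
    induction c using ind_mk with | h Q'' =>
    exact mk_eq_mk (OrderIso.prodAssoc Q Q' Q'')
  mul_comm := by
    intro a b
    induction a using ind_mk with | h Q =>
    induction b using ind_mk with | h Q' =>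
    exact mk_eq_mk OrderIso.prodComm
  one_mul := by
    intro a
    induction a using ind_mk with | h Q =>
    exact mk_eq_mk (Q := PUnit × Q)
      { toEquiv := Equiv.punitProd Q, map_rel_iff' := by simp [Prod.le_def] }
  mul_one := by
    intro a
    induction a using ind_mk with | h Q =>
    exact mk_eq_mk (Q := Q × PUnit)
      { toEquiv := Equiv.prodPUnit Q, map_rel_iff' := by simp [Prod.le_def] }

theorem mk_mul_mk (Q Q' : Type u) [PartialOrder Q] [PartialOrder Q'] :
    mk Q * mk Q' = mk (Q × Q') := rfl

end PosetClass

/-- A family of isomorphism classes of posets, closed under finite products, is *hereditary* if it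
consists of finite posets with least element `0̂` and greatest element `1̂` and contains, with `Q`,
all initial intervals `[0̂, x] = Iic x` and all final intervals `[x, 1̂] = Ici x` of `Q`. -/
structure IsHereditary (S : Submonoid PosetClass.{u}) : Prop where
  finite : ∀ (Q : Type u) [PartialOrder Q], PosetClass.mk Q ∈ S → Finite Q
  exists_isBot : ∀ (Q : Type u) [PartialOrder Q], PosetClass.mk Q ∈ S → ∃ b : Q, IsBot b
  exists_isTop : ∀ (Q : Type u) [PartialOrder Q], PosetClass.mk Q ∈ S → ∃ t : Q, IsTop t
  Iic_mem : ∀ (Q : Type u) [PartialOrder Q], PosetClass.mk Q ∈ S →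
    ∀ x : Q, PosetClass.mk (Set.Iic x) ∈ S
  Ici_mem : ∀ (Q : Type u) [PartialOrder Q], PosetClass.mk Q ∈ S →
    ∀ x : Q, PosetClass.mk (Set.Ici x) ∈ S

/-- The underlying algebra of the incidence Hopf algebra of a family of isomorphism classes of
posets: it has basis `F_[Q]` for `[Q]` in the family and product `F_[Q] F_[Q'] = F_[Q × Q']`.
(As on every ring there is at most one `ℚ`-algebra structure on it, the one of `MonoidAlgebra`.) -/
def IncidenceAlg (S : Submonoid PosetClass.{u}) : Type (u + 1) := MonoidAlgebra ℚ S

namespace IncidenceAlg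

noncomputable instance (S : Submonoid PosetClass.{u}) : CommRing (IncidenceAlg S) :=
  inferInstanceAs (CommRing (MonoidAlgebra ℚ S))

/-- The basis element `F_[Q]`. -/
noncomputable def F {S : Submonoid PosetClass.{u}} (c : S) : IncidenceAlg S :=
  (MonoidAlgebra.single c 1 : MonoidAlgebra ℚ S)

end IncidenceAlg

/-- A Hopf algebra structure on `IncidenceAlg S` is the incidence one if
`Δ F_[Q] = ∑ x ∈ Q, F_[0̂,x] ⊗ F_[x,1̂]`, and `ε F_[Q]` is `1` if `Q` has exactly one element
and `0` otherwise. -/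
def IsIncidenceHopf {S : Submonoid PosetClass.{u}} (hS : IsHereditary S)
    [HopfAlgebra ℚ (IncidenceAlg S)] : Prop :=
  (∀ (Q : Type u) [PartialOrder Q] (hQ : PosetClass.mk Q ∈ S),
    Coalgebra.comul (R := ℚ) (IncidenceAlg.F ⟨PosetClass.mk Q, hQ⟩) =
      ∑ᶠ x : Q, IncidenceAlg.F ⟨PosetClass.mk (Set.Iic x), hS.Iic_mem Q hQ x⟩ ⊗ₜ[ℚ]
        IncidenceAlg.F ⟨PosetClass.mk (Set.Ici x), hS.Ici_mem Q hQ x⟩) ∧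
  ∀ c : S, Coalgebra.counit (R := ℚ) (IncidenceAlg.F c) = Set.indicator {1} 1 c

namespace SetOperad

/-- `P(∅)` is empty and `P` of any singleton is a singleton. -/
class IsAugmented (P : SetOperad.{u}) : Prop where
  isEmpty : ∀ (I : Type) [Finite I] [IsEmpty I], IsEmpty (P.obj I)
  unique : ∀ (I : Type) [Finite I] [Unique I], Nonempty (Unique (P.obj I))

/-- All maps `x ↦ x ∘ (y i)` are injective. -/
def IsBasic (P : SetOperad.{u}) : Prop :=
  ∀ (I : Type) [Finite I] (J : I → Type) [∀ i, Finite (J i)] (y : ∀ i, P.obj (J i)),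
    Function.Injective fun x : P.obj I => P.comp x y

/-! ### The posets `Π_P(I)` -/

/-- An element of `Π_P(I) = (Comm ∘ P)(I)`: a partition of `I` (as an equivalence relation; its
parts are the fibres of `I → Quotient part`) and an element of `P` on each part. -/
structure PiElem (P : SetOperad.{u}) (I : Type) [Finite I] : Type u where
  part : Setoid I
  el : ∀ q : Quotient part, P.obj {i : I // Quotient.mk part i = q}

/-- If the partition `r` is finer than `s`, each part of `r` lies in a part of `s`. -/
def partMap {I : Type} {r s : Setoid I} (h : r ≤ s) : Quotient r → Quotient s :=
  Quotient.map' id h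

/-- If `r` is finer than `s`, the part `q` of `s` is the disjoint union of the parts of `r`
contained in it. -/
def partEquiv {I : Type} {r s : Setoid I} (h : r ≤ s) (q : Quotient s) :
    (Σ t : {t : Quotient r // partMap h t = q}, {i : I // Quotient.mk r i = t.1}) ≃
      {i : I // Quotient.mk s i = q} where
  toFun p := ⟨p.2.1, (congrArg (partMap h) p.2.2).trans p.1.2⟩
  invFun i := ⟨⟨Quotient.mk r i.1, i.2⟩, ⟨i.1, rfl⟩⟩
  left_inv p := Sigma.subtype_ext (Subtype.ext p.2.2) rfl
  right_inv _ := rfl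

variable (P : SetOperad.{u})

/-- `x ≤ y` in `Π_P(I)` if `y = θ ∘ x` for some `θ ∈ Π_P(π_x)`. The partition of the set `π_x`
underlying `θ` is forced to be the one that groups the parts of `x` lying in the same part of `y`,
so `θ` amounts to an element `θ_q ∈ P({t ∈ π_x | t ⊆ q})` for each part `q` of `y`. -/
instance (I : Type) [Finite I] : LE (P.PiElem I) where
  le x y := ∃ h : x.part ≤ y.part, ∀ q : Quotient y.part,
    ∃ θ : P.obj {t : Quotient x.part // partMap h t = q},
      P.map (partEquiv h q) (P.comp θ fun t => x.el t.1) = y.el q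

variable {P}

theorem map_map_symm {I J : Type} [Finite I] [Finite J] (e : I ≃ J) (x : P.obj J) :
    P.map e (P.map e.symm x) = x := by
  rw [← P.map_trans, Equiv.symm_trans_self, P.map_refl]

theorem map_unit_comp {K L : Type} [Finite K] [Finite L] {J : K → Type} [∀ k, Finite (J k)]
    (e : Unit ≃ K) (y : ∀ k, P.obj (J k)) (f : (Σ k, J k) ≃ L) (g : J (e ()) ≃ L)
    (h : ∀ j, f ⟨e (), j⟩ = g j) :
    P.map f (P.comp (P.map e P.unit) y) = P.map g (y (e ())) := by
  rw [P.comp_map_left, ← P.map_trans]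
  conv_rhs => rw [← P.unit_comp (y (e ())), ← P.map_trans]
  congr 1
  ext ⟨_, j⟩
  exact h j

theorem PiElem.le_of_el_eq {I : Type} [Finite I] (x y : P.PiElem I) (h : x = y) : x ≤ y := by
  subst h
  refine ⟨le_rfl, fun q => ?_⟩
  have hid : ∀ t : Quotient x.part, partMap (le_refl x.part) t = t := by
    intro t; induction t using Quotient.inductionOn; rfl
  let e : Unit ≃ {t : Quotient x.part // partMap (le_refl x.part) t = q} :=
    { toFun := fun _ => ⟨q, hid q⟩
      invFun := fun _ => ()
      left_inv := fun _ => rfl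
      right_inv := fun ⟨t, ht⟩ => by ext; simp [← ht, hid] }
  refine ⟨P.map e P.unit, ?_⟩
  rw [map_unit_comp e (fun t => x.el t.1) (partEquiv le_rfl q) (Equiv.refl _) (fun _ => rfl)]
  exact P.map_refl _

theorem PiElem.le_trans' {I : Type} [Finite I] {x y z : P.PiElem I} (hxy : x ≤ y) (hyz : y ≤ z) :
    x ≤ z := by
  obtain ⟨h, H⟩ := hxy
  obtain ⟨k, K⟩ := hyz
  choose θ hθ using H
  refine ⟨h.trans k, fun q => ?_⟩
  obtain ⟨η, hη⟩ := K q
  have hc : ∀ t : Quotient x.part, partMap k (partMap h t) = partMap (h.trans k) t := by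
    intro t; induction t using Quotient.inductionOn; rfl
  let e : (Σ s : {s : Quotient y.part // partMap k s = q},
      {t : Quotient x.part // partMap h t = s.1}) ≃
      {t : Quotient x.part // partMap (h.trans k) t = q} :=
    { toFun := fun p => ⟨p.2.1, by rw [← hc, p.2.2, p.1.2]⟩
      invFun := fun t => ⟨⟨partMap h t.1, by rw [hc, t.2]⟩, ⟨t.1, rfl⟩⟩
      left_inv := fun p => Sigma.subtype_ext (Subtype.ext p.2.2) rfl
      right_inv := fun _ => rfl }
  refine ⟨P.map e (P.comp η fun s => θ s.1), ?_⟩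
  rw [P.comp_map_left, ← P.map_trans, ← hη]
  have h1 : (fun s : {s : Quotient y.part // partMap k s = q} => y.el s.1) =
      fun s : {s : Quotient y.part // partMap k s = q} =>
        P.map (partEquiv h s.1) (P.comp (θ s.1) fun t => x.el t.1) := by
    funext s; exact (hθ s.1).symm
  rw [h1, P.comp_map_right, ← P.map_trans,
    ← P.assoc (J := fun s : {s : Quotient y.part // partMap k s = q} =>
        {t : Quotient x.part // partMap h t = s.1})
      (K := fun _ t => {i : I // Quotient.mk x.part i = t.1}) η
      (fun s : {s : Quotient y.part // partMap k s = q} => θ s.1) (fun _ t => x.el t.1),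
    ← P.map_trans]
  congr 1

theorem PiElem.le_antisymm' [P.IsAugmented] {I : Type} [Finite I] {x y : P.PiElem I}
    (hxy : x ≤ y) (hyx : y ≤ x) : x = y := by
  obtain ⟨h, H⟩ := hxy
  obtain ⟨h', -⟩ := hyx
  obtain ⟨r, a⟩ := x
  obtain ⟨s, b⟩ := y
  obtain rfl : r = s := le_antisymm h h'
  congr 1
  funext q
  obtain ⟨θ, hθ⟩ := H q
  have hid : ∀ t : Quotient r, partMap h t = t := by
    intro t; induction t using Quotient.inductionOn; rfl
  let e : Unit ≃ {t : Quotient r // partMap h t = q} :=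
    { toFun := fun _ => ⟨q, hid q⟩
      invFun := fun _ => ()
      left_inv := fun _ => rfl
      right_inv := fun ⟨t, ht⟩ => by ext; simp [← ht, hid] }
  have hu : θ = P.map e P.unit := by
    let _ : Unique {t : Quotient r // partMap h t = q} := e.symm.unique
    obtain ⟨hU⟩ := IsAugmented.unique (P := P) {t : Quotient r // partMap h t = q}
    exact Subsingleton.elim _ _
  subst hu
  refine Eq.trans ?_ hθ
  symm
  refine (map_unit_comp e (fun t => a t.1) (partEquiv h q) (Equiv.refl _) (fun _ => rfl)).trans ?_
  exact P.map_refl _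

instance [P.IsAugmented] (I : Type) [Finite I] : PartialOrder (P.PiElem I) where
  le_refl x := PiElem.le_of_el_eq x x rfl
  le_trans _ _ _ := PiElem.le_trans'
  le_antisymm _ _ := PiElem.le_antisymm'

/-- The parts of the partition into singletons. -/
noncomputable def botPartEquiv {I : Type} (q : Quotient (⊥ : Setoid I)) :
    Unit ≃ {i : I // Quotient.mk ⊥ i = q} :=
  haveI : Unique {i : I // Quotient.mk ⊥ i = q} :=
    { default := ⟨q.out, q.out_eq⟩
      uniq := by
        rintro ⟨i, rfl⟩
        ext
        exact (Quotient.exact (Quotient.out_eq (Quotient.mk (⊥ : Setoid I) i))).symm }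
  Equiv.ofUnique _ _

/-- The element `0̂` of `Π_P(I)`: the partition into singletons, with the unit on each part. -/
noncomputable def PiElem.zero (P : SetOperad.{u}) (I : Type) [Finite I] : P.PiElem I where
  part := ⊥
  el q := P.map (botPartEquiv q) P.unit

/-- An element of `P(I)` as an element of `Π_P(I)` with a single part. -/
def PiElem.single {I : Type} [Finite I] (y : P.obj I) : P.PiElem I where
  part := ⊤
  el q := P.map
    (Equiv.subtypeUnivEquiv (p := fun i : I => Quotient.mk ⊤ i = q) fun _ => by
      induction q using Quotient.inductionOn
      exact Quotient.sound trivial).symm y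

variable (P)

/-! ### Coinvariants, intervals, and the incidence Hopf algebra of an operad -/

/-- Two elements of `P(n)` are equivalent if they lie in one orbit of the symmetric group. -/
def orbitSetoid (n : ℕ) : Setoid (P.obj (Fin n)) where
  r x y := ∃ σ : Equiv.Perm (Fin n), P.map σ x = y
  iseqv :=
    { refl := fun x => ⟨Equiv.refl _, P.map_refl x⟩
      symm := by
        rintro x _ ⟨σ, rfl⟩
        exact ⟨σ.symm, by rw [← P.map_trans, Equiv.self_trans_symm, P.map_refl]⟩
      trans := by
        rintro x _ _ ⟨σ, rfl⟩ ⟨τ, rfl⟩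
        exact ⟨σ.trans τ, P.map_trans σ τ x⟩ }

/-- The set `A_P = ∐ n, P(n)_{S_n}` of coinvariants. -/
def Coinv : Type u := Σ n : ℕ, Quotient (P.orbitSetoid n)

variable {P}

/-- The coinvariant `⟨x⟩` of an element `x ∈ P(I)`. -/
noncomputable def cls {I : Type} [Finite I] (x : P.obj I) : P.Coinv :=
  ⟨Nat.card I, Quotient.mk _ (P.map (Finite.equivFin I) x)⟩

namespace Coinv

/-- The `n` with `α ∈ P(n)_{S_n}`. -/
def arity (α : P.Coinv) : ℕ := α.1

/-- A representative `r(α) ∈ P(n)` of `α`. -/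
noncomputable def rep (α : P.Coinv) : P.obj (Fin α.arity) := Quotient.out α.2

/-- The order of the automorphism group (the stabilizer in `S_n`) of `r(α)`. -/
noncomputable def cardAut (α : P.Coinv) : ℕ :=
  Nat.card {σ : Equiv.Perm (Fin α.arity) // P.map σ α.rep = α.rep}

/-- The poset `P_α`, the interval `[0̂, r(α)]` of `Π_P(n)`. -/
abbrev Interval [P.IsAugmented] (α : P.Coinv) : Type u :=
  Set.Icc (PiElem.zero P (Fin α.arity)) (PiElem.single α.rep)

end Coinv

variable (P)

/-- The coinvariant `ε` of the unit of the operad. -/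
noncomputable def one : P.Coinv := cls P.unit

/-- The isomorphism classes of finite products of intervals `P_α`. -/
def intervalClasses [P.IsAugmented] : Submonoid PosetClass.{u} :=
  Submonoid.closure (Set.range fun α : P.Coinv => PosetClass.mk α.Interval)

/-- The algebra `H_P`, the incidence algebra of the family of products of intervals `P_α`. -/
abbrev IncAlg [P.IsAugmented] : Type (u + 1) := IncidenceAlg P.intervalClasses

variable {P}

/-- The element `F_[α]` of `H_P`. -/
noncomputable def F [P.IsAugmented] (α : P.Coinv) : P.IncAlg :=
  IncidenceAlg.F ⟨PosetClass.mk α.Interval, Submonoid.subset_closure ⟨α, rfl⟩⟩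

/-! ### The group `G_P` and its coordinate Hopf algebra -/

/-- The coefficient of `α` in the product
`g × h = ∑ m, ∑ n_1, …, n_m, ⟨x_m ∘ (y_{n_1}, …, y_{n_m})⟩` of the formal series `g` and `h`, where
`x_m = ∑ g_a r(a)` over `a ∈ P(m)_{S_m}` and `y_n = ∑ h_b r(b)` over `b ∈ P(n)_{S_n}`.
The product is linear in `x_m` and in each `y_{n_i}`, so this coefficient is the sum of
`g_a h_{b_1} ⋯ h_{b_m}` over all `a` and `b_1, …, b_m` with
`⟨r(a) ∘ (r(b_1), …, r(b_m))⟩ = α`; for a basic augmented operad with finite intervals `P_α` there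
are finitely many of these. -/
noncomputable def mulCoeff {R : Type v} [CommSemiring R] (g h : P.Coinv → R) (α : P.Coinv) : R :=
  ∑ᶠ t : {t : Σ a : P.Coinv, (Fin a.arity → P.Coinv) //
      cls (P.comp t.1.rep fun i => (t.2 i).rep) = α},
    g t.1.1 * ∏ i, h (t.1.2 i)

variable (P)

/-- The `R`-points of `G_P`: formal series `∑ α, g_α α` with coefficients in `R` and `g_ε = 1`. -/
def GroupPts (R : Type v) [CommSemiring R] : Type (max u v) := {g : P.Coinv → R // g P.one = 1}

/-- The algebra `ℚ[G_P]`: the free commutative `ℚ`-algebra on the `G_α`, `α ≠ ε`.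
(As on every ring there is at most one `ℚ`-algebra structure on it, the one of `MvPolynomial`.) -/
def CoordAlg : Type u := MvPolynomial {α : P.Coinv // α ≠ P.one} ℚ

noncomputable instance : CommRing P.CoordAlg :=
  inferInstanceAs (CommRing (MvPolynomial {α : P.Coinv // α ≠ P.one} ℚ))

variable {P}

open scoped Classical in
/-- The coordinate function `G_α`, with `G_ε = 1`. -/
noncomputable def G (α : P.Coinv) : P.CoordAlg :=
  if h : α = P.one then 1
  else (MvPolynomial.X ⟨α, h⟩ : MvPolynomial {α : P.Coinv // α ≠ P.one} ℚ)

variable (P)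

/-- A Hopf algebra structure on `ℚ[G_P]` is the one of functions on the group `G_P` if
`Δ G_α = ∑ G_{b_1} ⋯ G_{b_m} ⊗ G_a`, summed over all `a`, `b_1, …, b_m` with
`⟨r(a) ∘ (r(b_1), …, r(b_m))⟩ = α` (that is, `Δ f (h ⊗ g) = f (g × h)`: the left factor carries the
inner series), and `ε` is the evaluation at the neutral element of `G_P`. -/
def IsCoordHopf [HopfAlgebra ℚ P.CoordAlg] : Prop :=
  (∀ α : P.Coinv, Coalgebra.comul (R := ℚ) (G α) =
    mulCoeff (R := P.CoordAlg ⊗[ℚ] P.CoordAlg) (fun a => 1 ⊗ₜ[ℚ] G a) (fun b => G b ⊗ₜ[ℚ] 1) α) ∧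
  ∀ α : P.Coinv, Coalgebra.counit (R := ℚ) (G α) = Set.indicator {P.one} 1 α

end SetOperad

/-! ### Decompositions indexed by arbitrary finite sets, and their comparison with `PiElem` -/

namespace SetOperad

variable {P : SetOperad.{u}}

/-! Everything rests on two descriptions of intervals in $\Pi_P(I)$. Let $y = \theta\circ x$ have a
single part. The map $t\mapsto t\circ x$ identifies $[\widehat 0,\theta]$ with $[x,y]$
(`Dec.composeIso`); it reflects the order because a basic operad allows $x$ to be cancelled.
Restriction to the parts of $x$ identifies $[\widehat 0,x]$ with $\prod_J[\widehat 0,x_J]$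
(`Dec.restrictIso`). Hence initial and final intervals of the $P_\alpha$ are again products of such
posets, and the family is hereditary. To avoid quotient types, both isomorphisms are built on
decompositions `Dec`, whose parts are labelled by any finite set; these form a preorder that is
equivalent to $\Pi_P(I)$.

For a hereditary family, coassociativity is the double count of chains $y\le x$ in $Q$. The antipode
is the geometric series in $\varepsilon-\mathrm{id}$ for convolution, which is locally finite: the
$k$-th power kills $F_{[Q]}$ as soon as $\#Q\le k$.

For series, both bracketings of a triple product are sums over trees of height two, cut below the
top level or above the root (`mulCoeff_assoc`). Inverses are found by recursion on the arity. The
Hopf algebra axioms of the coordinate algebra are these group laws applied to universal series.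

The link between the two sides is a double count (`sum_tree_eq_sum_interval`). A presentation of
$r(\alpha)$ as a relabelled composite of representatives $r(a)\circ(r(b_i))$ is the same as an $x\in
P_\alpha$ together with labels of its outer factor and of its parts (`treeLabelEquiv`). A fixed tree
$(a,b)$ with composite of class $\alpha$ has $\#\mathrm{Aut}(\alpha)$ presentations, and a fixed $x$
has $\#\mathrm{Aut}(a)\prod\#\mathrm{Aut}(b_i)$ of them. So the coefficients $1/\#\mathrm{Aut}$ turn
the sum over trees in $\Delta G_\alpha$ into the sum over $P_\alpha$ in $\Delta F_{[\alpha]}$. Since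
$\#\mathrm{Aut}$ is invertible in $\mathbb Q$, $\rho$ is surjective, so that precomposition with it
embeds the points of $H_P$ into $G_P(R)$. -/

theorem map_symm_map {I J : Type} [Finite I] [Finite J] (e : I ≃ J) (x : P.obj I) :
    P.map e.symm (P.map e x) = x := by
  rw [← P.map_trans, Equiv.self_trans_symm, P.map_refl]

theorem map_injective {I J : Type} [Finite I] [Finite J] (e : I ≃ J) :
    Function.Injective (P.map e) :=
  Function.LeftInverse.injective (map_symm_map e)

theorem map_congr {I J : Type} [Finite I] [Finite J] {e e' : I ≃ J} (h : ∀ i, e i = e' i)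
    (x : P.obj I) : P.map e x = P.map e' x := by
  rw [Equiv.ext h]

theorem map_comp_map_left {I I' L : Type} [Finite I] [Finite I'] [Finite L] {J : I' → Type}
    [∀ i, Finite (J i)] (f : (Σ i, J i) ≃ L) (e : I ≃ I') (x : P.obj I) (y : ∀ i, P.obj (J i)) :
    P.map f (P.comp (P.map e x) y) =
      P.map ((Equiv.sigmaCongrLeft e).trans f) (P.comp x fun i => y (e i)) := by
  rw [P.comp_map_left, ← P.map_trans]

theorem map_comp_map_right {I L : Type} [Finite I] [Finite L] {J K : I → Type} [∀ i, Finite (J i)]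
    [∀ i, Finite (K i)] (f : (Σ i, K i) ≃ L) (e : ∀ i, J i ≃ K i) (x : P.obj I)
    (y : ∀ i, P.obj (J i)) :
    P.map f (P.comp x fun i => P.map (e i) (y i)) =
      P.map ((Equiv.sigmaCongrRight e).trans f) (P.comp x y) := by
  rw [P.comp_map_right, ← P.map_trans]

/-- The fibre of a composite map is the disjoint union of the fibres of the first map. -/
def fibComp {I K L : Type} {f : I → K} {h : K → L} {g : I → L} (hg : ∀ i, h (f i) = g i) (l : L) :
    (Σ t : {k // h k = l}, {i // f i = t.1}) ≃ {i // g i = l} where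
  toFun p := ⟨p.2.1, by rw [← hg, p.2.2, p.1.2]⟩
  invFun i := ⟨⟨f i.1, (hg i.1).trans i.2⟩, ⟨i.1, rfl⟩⟩
  left_inv p := Sigma.subtype_ext (Subtype.ext p.2.2) rfl
  right_inv _ := rfl

/-- Operadic associativity for fibres of maps $I\to K\to L\to M$. Naming the composite maps by
hypotheses instead of by `∘` lets it apply when they agree only pointwise. -/
theorem map_comp_assoc {I K L M : Type} [Finite I] [Finite K] [Finite L]
    {f : I → K} {h : K → L} {g : I → L} (hg : ∀ i, h (f i) = g i)
    {k : L → M} {g' : I → M} (hg' : ∀ i, k (g i) = g' i) {h' : K → M} (hh' : ∀ i, k (h i) = h' i)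
    (hf' : ∀ i, h' (f i) = g' i) (m : M) (θ : P.obj {l // k l = m})
    (η : ∀ l, P.obj {i // h i = l}) (y : ∀ l, P.obj {i // f i = l}) :
    P.map (fibComp hg' m) (P.comp θ fun s => P.map (fibComp hg s.1)
      (P.comp (η s.1) fun t => y t.1)) =
    P.map (fibComp hf' m) (P.comp (P.map (fibComp hh' m) (P.comp θ fun s => η s.1))
      fun t => y t.1) := by
  rw [P.comp_map_left, ← P.map_trans, P.comp_map_right, ← P.map_trans,
    ← P.assoc (J := fun s : {s : L // k s = m} => {t : K // h t = s.1})
      (K := fun _ t => {i : I // f i = t.1}) θ (fun s => η s.1) (fun _ t => y t.1),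
    ← P.map_trans]
  refine map_congr ?_ _
  exact fun _ => rfl

/-- Replaces a cast along `k = k'` by a relabelling that does not move the underlying points. -/
theorem map_el_eq {I K : Type} [Finite I] {f : I → K} (y : ∀ k, P.obj {i // f i = k}) {k k' : K}
    (h : k = k') (e : {i // f i = k} ≃ {i // f i = k'}) (he : ∀ i, (e i).1 = i.1) :
    P.map e (y k) = y k' := by
  subst h
  obtain rfl : e = Equiv.refl _ := by ext i; exact he i
  exact P.map_refl _

/-- A decomposition of `I`, given by a map from `I` to a finite set and an element of `P` on each
fibre. -/
structure Dec (P : SetOperad.{u}) (I : Type) [Finite I] : Type (max u 1) where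
  K : Type
  fin : Finite K
  f : I → K
  y : ∀ k, P.obj {i : I // f i = k}

namespace Dec

attribute [instance] Dec.fin

/-- An empty fibre would carry an element of $P(\emptyset)$, which is empty. -/
theorem surj [P.IsAugmented] {I : Type} [Finite I] (d : P.Dec I) : Function.Surjective d.f := by
  intro k
  by_contra hk
  have : IsEmpty {i : I // d.f i = k} := ⟨fun i => hk ⟨i.1, i.2⟩⟩
  exact (IsAugmented.isEmpty (P := P) {i : I // d.f i = k}).false (d.y k)

instance (I : Type) [Finite I] : LE (P.Dec I) where
  le d d' := ∃ (h : d.K → d'.K) (hg : ∀ i, h (d.f i) = d'.f i), ∀ l,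
    ∃ θ : P.obj {k // h k = l}, P.map (fibComp hg l) (P.comp θ fun t => d.y t.1) = d'.y l

theorem le_of_equiv {I : Type} [Finite I] {d d' : P.Dec I} (b : d.K ≃ d'.K)
    (hb : ∀ i, b (d.f i) = d'.f i)
    (H : ∀ k, P.map (Equiv.subtypeEquivRight fun i => by rw [← hb, b.apply_eq_iff_eq]) (d.y k) =
      d'.y (b k)) : d ≤ d' := by
  refine ⟨b, hb, fun l => ?_⟩
  obtain ⟨k, rfl⟩ := b.surjective l
  let e : Unit ≃ {t : d.K // b t = b k} :=
    { toFun := fun _ => ⟨k, rfl⟩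
      invFun := fun _ => ()
      left_inv := fun _ => rfl
      right_inv := fun ⟨t, ht⟩ => by ext; exact (b.injective ht).symm }
  -- The fibre of a bijection is a single point, so the outer factor is the unit.
  refine ⟨P.map e P.unit, ?_⟩
  rw [← H]
  exact map_unit_comp e (fun t => d.y t.1) _ _ (fun _ => rfl)

theorem ge_of_equiv {I : Type} [Finite I] {d d' : P.Dec I} (b : d.K ≃ d'.K)
    (hb : ∀ i, b (d.f i) = d'.f i)
    (H : ∀ k, P.map (Equiv.subtypeEquivRight fun i => by rw [← hb, b.apply_eq_iff_eq]) (d.y k) =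
      d'.y (b k)) : d' ≤ d := by
  refine le_of_equiv b.symm (fun i => by rw [← hb, b.symm_apply_apply]) fun k => ?_
  obtain ⟨k, rfl⟩ := b.surjective k
  rw [← H, ← P.map_trans]
  exact map_el_eq d.y (b.symm_apply_apply k).symm _ fun _ => rfl

instance (I : Type) [Finite I] : Preorder (P.Dec I) where
  le_refl d := le_of_equiv (Equiv.refl _) (fun _ => rfl) fun _ => P.map_refl _
  le_trans d d' d'' := by
    rintro ⟨h, hg, H⟩ ⟨h', hg', H'⟩
    choose θ hθ using H
    refine ⟨h' ∘ h, fun i => by simp [hg, hg'], fun l => ?_⟩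
    obtain ⟨η, hη⟩ := H' l
    refine ⟨P.map (fibComp (f := h) (h := h') (fun _ => rfl) l) (P.comp η fun s => θ s.1), ?_⟩
    rw [← map_comp_assoc hg hg', ← hη]
    simp only [hθ]

/-- The decomposition underlying an element of `Π_P(I)`. -/
abbrev ofPi {I : Type} [Finite I] (x : P.PiElem I) : P.Dec I :=
  ⟨Quotient x.part, inferInstance, Quotient.mk _, x.el⟩

/-- The comparison map between the sets of parts is forced by its values on classes of points, so it
is `partMap`. -/
theorem ofPi_le_ofPi {I : Type} [Finite I] {x x' : P.PiElem I} : ofPi x ≤ ofPi x' ↔ x ≤ x' := by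
  constructor
  · rintro ⟨h, hg, H⟩
    have hle : x.part ≤ x'.part := fun i j hij => Quotient.exact (by
      have := congrArg h (Quotient.sound hij : Quotient.mk x.part i = Quotient.mk x.part j)
      exact (hg i).symm.trans (this.trans (hg j)))
    obtain rfl : h = partMap hle := by
      funext t; induction t using Quotient.inductionOn; exact hg _
    exact ⟨hle, H⟩
  · rintro ⟨h, H⟩
    exact ⟨partMap h, fun _ => rfl, H⟩

/-- The element of `Π_P(I)` given by a decomposition. -/
def toPi {I : Type} [Finite I] (d : P.Dec I) : P.PiElem I where
  part := Setoid.ker d.f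
  el q := P.map (Equiv.subtypeEquivRight fun i => by
    induction q using Quotient.inductionOn
    exact (Quotient.eq (r := Setoid.ker d.f)).symm) (d.y (Quotient.lift d.f (fun _ _ h => h) q))

variable {I : Type} [Finite I]

/-- The decomposition with one part. -/
abbrev single (y : P.obj I) : P.Dec I :=
  ⟨Unit, inferInstance, fun _ => (), fun _ =>
    P.map (Equiv.subtypeUnivEquiv fun _ => Subsingleton.elim _ _).symm y⟩

theorem le_single_iff {d : P.Dec I} {y : P.obj I} :
    d ≤ single y ↔ ∃ θ : P.obj d.K, P.map (Equiv.sigmaFiberEquiv d.f) (P.comp θ d.y) = y := by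
  constructor
  · rintro ⟨h, hg, H⟩
    obtain ⟨θ, hθ⟩ := H ()
    refine ⟨P.map (Equiv.subtypeUnivEquiv (p := fun k : d.K => h k = ()) fun _ => rfl) θ, ?_⟩
    rw [P.comp_map_left, ← P.map_trans]
    apply map_injective (Equiv.subtypeUnivEquiv (p := fun _ : I => () = ()) fun _ => rfl).symm
    refine Eq.trans ?_ hθ
    rw [← P.map_trans]
    rfl
  · rintro ⟨θ, rfl⟩
    refine ⟨fun _ => (), fun _ => rfl, fun l =>
      ⟨P.map (Equiv.subtypeUnivEquiv (p := fun _ : d.K => () = l) fun _ => rfl).symm θ, ?_⟩⟩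
    refine (map_comp_map_left _ _ _ _).trans ?_
    refine Eq.trans ?_ (P.map_trans _ _ _)
    rfl

variable [P.IsAugmented]

/-- The parts of the partition given by a decomposition. -/
noncomputable def partsEquiv (d : P.Dec I) : (ofPi d.toPi).K ≃ d.K :=
  Equiv.ofBijective (Quotient.lift d.f (fun _ _ h => h)) ⟨by
    intro a b
    induction a using Quotient.inductionOn
    induction b using Quotient.inductionOn
    exact fun h => Quotient.sound h, fun k => by
    obtain ⟨i, rfl⟩ := d.surj k
    exact ⟨Quotient.mk _ i, rfl⟩⟩

theorem toPi_le (d : P.Dec I) : ofPi d.toPi ≤ d :=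
  le_of_equiv d.partsEquiv (fun _ => rfl) fun k => by
    refine (P.map_trans _ _ _).symm.trans ?_
    exact P.map_refl _

theorem le_toPi (d : P.Dec I) : d ≤ ofPi d.toPi :=
  ge_of_equiv d.partsEquiv (fun _ => rfl) fun k => by
    refine (P.map_trans _ _ _).symm.trans ?_
    exact P.map_refl _

/-- A decomposition and its `toPi` lie below each other in the preorder, so inequalities can be
moved freely between `Dec` and `PiElem`. -/
theorem ofPi_le_iff {d : P.Dec I} {x : P.PiElem I} : ofPi x ≤ d ↔ x ≤ d.toPi := by
  rw [← ofPi_le_ofPi]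
  exact ⟨fun h => h.trans d.le_toPi, fun h => h.trans d.toPi_le⟩

theorem le_ofPi_iff {d : P.Dec I} {x : P.PiElem I} : d ≤ ofPi x ↔ d.toPi ≤ x := by
  rw [← ofPi_le_ofPi]
  exact ⟨fun h => d.toPi_le.trans h, fun h => d.le_toPi.trans h⟩

theorem toPi_le_toPi {d d' : P.Dec I} : d.toPi ≤ d'.toPi ↔ d ≤ d' := by
  rw [← ofPi_le_iff]
  exact ⟨fun h => d.le_toPi.trans h, fun h => d.toPi_le.trans h⟩

theorem toPi_ofPi (x : P.PiElem I) : (ofPi x).toPi = x :=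
  le_antisymm (le_ofPi_iff.1 le_rfl) (ofPi_le_iff.1 le_rfl)

theorem toPi_single (y : P.obj I) : (single y).toPi = PiElem.single y := by
  -- On an empty set the top relation would have no class, whereas `single` always has one part;
  -- augmentation excludes this case.
  have hI : Nonempty I := by
    by_contra h
    rw [not_nonempty_iff] at h
    exact (IsAugmented.isEmpty (P := P) I).false y
  let b : Unit ≃ Quotient (⊤ : Setoid I) :=
    { toFun := fun _ => Quotient.mk _ hI.some
      invFun := fun _ => ()
      left_inv := fun _ => rfl
      right_inv := fun q => by
        induction q using Quotient.inductionOn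
        exact Quotient.sound trivial }
  have hb : ∀ i, b ((single y).f i) = (ofPi (PiElem.single y)).f i :=
    fun i => Quotient.sound trivial
  have H : ∀ k, P.map (Equiv.subtypeEquivRight fun i => iff_of_true rfl (hb i).symm)
      ((single y).y k) = (ofPi (PiElem.single y)).y (b k) := by
    exact fun k => (P.map_trans _ _ _).symm
  exact le_antisymm (le_ofPi_iff.1 (le_of_equiv b hb H)) (ofPi_le_iff.1 (ge_of_equiv b hb H))

end Dec

theorem PiElem.zero_le {I : Type} [Finite I] (x : P.PiElem I) : PiElem.zero P I ≤ x := by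
  have h : (⊥ : Setoid I) ≤ x.part := bot_le
  let b : Quotient (⊥ : Setoid I) ≃ I :=
    { toFun := Quotient.lift id fun _ _ h => h
      invFun := Quotient.mk _
      left_inv := fun q => by induction q using Quotient.inductionOn; rfl
      right_inv := fun _ => rfl }
  refine ⟨h, fun q => ?_⟩
  let e : {i // Quotient.mk x.part i = q} ≃ {t // partMap h t = q} :=
    b.symm.subtypeEquiv fun _ => Iff.rfl
  -- The outer factor over $\widehat 0$ is the element itself, with each point replaced by its
  -- singleton class; the right unit law concludes.
  refine ⟨P.map e (x.el q), ?_⟩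
  refine (map_comp_map_left _ _ _ _).trans ?_
  refine (map_comp_map_right _ (fun i : {i // Quotient.mk x.part i = q} => botPartEquiv (e i).1)
    (x.el q) (fun _ => P.unit)).trans ?_
  conv_rhs => rw [← P.comp_unit (x.el q)]
  refine map_congr (fun p => Subtype.ext ?_) _
  exact Quotient.exact (botPartEquiv (e p.1).1 p.2).2

end SetOperad

/-! ### Final intervals: composition with a fixed decomposition -/

namespace SetOperad

variable {P : SetOperad.{u}}

namespace Dec

variable {I : Type} [Finite I]

/-- The composite `t ∘ d` of a decomposition `d` of `I` with a decomposition `t` of its parts. -/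
abbrev compose (d : P.Dec I) (t : P.Dec d.K) : P.Dec I :=
  ⟨t.K, t.fin, t.f ∘ d.f, fun l => P.map (fibComp (f := d.f) (h := t.f) (fun _ => rfl) l)
    (P.comp (t.y l) fun k => d.y k.1)⟩

theorem le_compose (d : P.Dec I) (t : P.Dec d.K) : d ≤ d.compose t :=
  ⟨t.f, fun _ => rfl, fun l => ⟨t.y l, rfl⟩⟩

/-- The outer factors witnessing `d ≤ z` assemble into a decomposition of the parts of `d`. -/
theorem exists_compose {d z : P.Dec I} (h : d ≤ z) :
    ∃ t, d.compose t ≤ z ∧ z ≤ d.compose t := by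
  obtain ⟨h, hg, H⟩ := h
  choose θ hθ using H
  refine ⟨⟨z.K, z.fin, h, θ⟩, ?_⟩
  have key : ∀ l, P.map (Equiv.subtypeEquivRight fun i => by simp [hg])
      ((d.compose ⟨z.K, z.fin, h, θ⟩).y l) = z.y l := by
    intro l
    rw [← hθ l]
    exact (P.map_trans _ _ _).symm
  exact ⟨le_of_equiv (Equiv.refl _) hg key, ge_of_equiv (Equiv.refl _) hg key⟩

section

variable [P.IsAugmented]

/-- By associativity, a witness for `t ≤ t'` is also one for the composites. Conversely, the
equation between composites loses its inner factors by basicness, and surjectivity of `d.f` carries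
the comparison of labels from points to parts of `d`. -/
theorem compose_le_compose (hP : P.IsBasic) (d : P.Dec I) {t t' : P.Dec d.K} :
    d.compose t ≤ d.compose t' ↔ t ≤ t' := by
  constructor
  · rintro ⟨h, hg, H⟩
    have hg' : ∀ k, h (t.f k) = t'.f k := fun k => by
      obtain ⟨i, rfl⟩ := d.surj k
      exact hg i
    refine ⟨h, hg', fun l => ?_⟩
    obtain ⟨θ, hθ⟩ := H l
    refine ⟨θ, ?_⟩
    have := (map_comp_assoc (f := d.f) (h := t.f) (fun _ => rfl) hg hg' (fun _ => rfl) l θ t.y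
      d.y).symm.trans hθ
    exact hP _ _ _ (map_injective _ this)
  · rintro ⟨h, hg, H⟩
    refine ⟨h, fun i => hg _, fun l => ?_⟩
    obtain ⟨θ, hθ⟩ := H l
    refine ⟨θ, ?_⟩
    refine (map_comp_assoc (f := d.f) (h := t.f) (fun _ => rfl) (fun i => hg _) hg (fun _ => rfl)
      l θ t.y d.y).trans ?_
    rw [hθ]

theorem compose_single (d : P.Dec I) (θ : P.obj d.K) :
    (d.compose (single θ)).toPi =
      PiElem.single (P.map (Equiv.sigmaFiberEquiv d.f) (P.comp θ d.y)) := by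
  rw [← toPi_single]
  have key : ∀ l, P.map (Equiv.refl _) ((d.compose (single θ)).y l) =
      (single (P.map (Equiv.sigmaFiberEquiv d.f) (P.comp θ d.y))).y l := by
    intro l
    rw [P.map_refl]
    refine (map_comp_map_left (fibComp (f := d.f) (h := fun _ => ()) (fun _ => rfl) l)
      (Equiv.subtypeUnivEquiv (p := fun _ : d.K => () = l) fun _ => rfl).symm θ
      fun k => d.y k.1).trans ?_
    exact P.map_trans (Equiv.sigmaFiberEquiv d.f)
      (Equiv.subtypeUnivEquiv (p := fun _ : I => () = l) fun _ => rfl).symm (P.comp θ d.y)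
  exact le_antisymm (toPi_le_toPi.2 (le_of_equiv (Equiv.refl _) (fun _ => rfl) key))
    (toPi_le_toPi.2 (ge_of_equiv (Equiv.refl _) (fun _ => rfl) key))

/-- A final interval of `Π_P(I)` is the interval of the outer composition factor. -/
noncomputable def composeIso (hP : P.IsBasic) (d : P.Dec I) (θ : P.obj d.K) :
    Set.Icc (PiElem.zero P d.K) (PiElem.single θ) ≃o
      Set.Icc d.toPi (PiElem.single (P.map (Equiv.sigmaFiberEquiv d.f) (P.comp θ d.y))) :=
  RelIso.ofSurjective (OrderEmbedding.ofMapLEIff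
    (fun t => ⟨(d.compose (ofPi t.1)).toPi, toPi_le_toPi.2 (d.le_compose _), by
      rw [← compose_single, toPi_le_toPi, compose_le_compose hP, ofPi_le_iff, toPi_single]
      exact t.2.2⟩)
    (fun t t' => by
      rw [← Subtype.coe_le_coe, toPi_le_toPi, compose_le_compose hP, ofPi_le_ofPi,
        Subtype.coe_le_coe])) (by
    rintro ⟨z, hz, hz'⟩
    -- An element above `d` factors through `d`; the upper bound on `z` then becomes `t ≤ single θ`
    -- after cancelling `d`.
    obtain ⟨t, ht, ht'⟩ := exists_compose (le_ofPi_iff.2 hz)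
    have hzt : (d.compose t).toPi = z := le_antisymm (le_ofPi_iff.1 ht) (ofPi_le_iff.1 ht')
    refine ⟨⟨t.toPi, PiElem.zero_le _, ?_⟩, Subtype.ext (Eq.trans ?_ hzt)⟩
    · rw [← hzt, ← compose_single, toPi_le_toPi, compose_le_compose hP] at hz'
      rwa [← toPi_single, toPi_le_toPi]
    · exact le_antisymm
        (toPi_le_toPi.2 ((compose_le_compose hP d).2 t.toPi_le))
        (toPi_le_toPi.2 ((compose_le_compose hP d).2 t.le_toPi)))

end

/-- The decomposition of `J` into singletons, labelled by a bijection. -/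
noncomputable abbrev ofEquiv (P : SetOperad.{u}) {J : Type} [Finite J] (e : I ≃ J) : P.Dec J :=
  ⟨I, inferInstance, e.symm, fun i => P.map
    { toFun := fun _ => ⟨e i, e.symm_apply_apply i⟩
      invFun := fun _ => ()
      left_inv := fun _ => rfl
      right_inv := fun j => Subtype.ext ((congrArg e j.2).symm.trans (e.apply_symm_apply _)) }
      P.unit⟩

/-- Relabelling is composition with units. Thus invariance of intervals under relabelling is a case
of `composeIso`, in which the final interval starts at $\widehat 0$. -/
theorem map_comp_ofEquiv {J : Type} [Finite J] (e : I ≃ J) (θ : P.obj I) :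
    P.map (Equiv.sigmaFiberEquiv (ofEquiv P e).f) (P.comp θ (ofEquiv P e).y) = P.map e θ := by
  refine (map_comp_map_right (P := P) _ _ θ (fun _ => P.unit)).trans ?_
  conv_rhs => rw [← P.comp_unit θ, ← P.map_trans]
  exact map_congr (fun _ => rfl) _

variable [P.IsAugmented]

theorem toPi_ofEquiv {J : Type} [Finite J] (e : I ≃ J) :
    (ofEquiv P e).toPi = PiElem.zero P J := by
  refine le_antisymm ?_ (PiElem.zero_le _)
  rw [← le_ofPi_iff]
  let b : I ≃ Quotient (⊥ : Setoid J) :=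
    { toFun := fun i => Quotient.mk _ (e i)
      invFun := Quotient.lift e.symm fun _ _ h => congrArg e.symm h
      left_inv := fun i => e.symm_apply_apply i
      right_inv := fun q => by
        induction q using Quotient.inductionOn
        exact congrArg _ (e.apply_symm_apply _) }
  have hb : ∀ j : J, b (e.symm j) = Quotient.mk _ j :=
    fun j => congrArg _ (e.apply_symm_apply _)
  refine le_of_equiv b hb fun i => ?_
  refine (P.map_trans _ _ _).symm.trans (map_congr (fun _ => ?_) _)
  exact (botPartEquiv (b i)).symm.injective rfl

end Dec

/-- The class of the interval `[0̂, y]` of `Π_P(I)`. -/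
def ivl [P.IsAugmented] {I : Type} [Finite I] (y : P.obj I) : PosetClass.{u} :=
  PosetClass.mk (Set.Icc (PiElem.zero P I) (PiElem.single y))

variable [P.IsAugmented] {I : Type} [Finite I]

theorem mk_Icc_compose (hP : P.IsBasic) (d : P.Dec I) (θ : P.obj d.K) :
    PosetClass.mk (Set.Icc d.toPi
      (PiElem.single (P.map (Equiv.sigmaFiberEquiv d.f) (P.comp θ d.y)))) = ivl θ :=
  (PosetClass.mk_eq_mk (d.composeIso hP θ)).symm

theorem ivl_map (hP : P.IsBasic) {J : Type} [Finite J] (e : I ≃ J) (y : P.obj I) :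
    ivl (P.map e y) = ivl y := by
  have := mk_Icc_compose hP (Dec.ofEquiv P e) y
  rwa [Dec.toPi_ofEquiv, Dec.map_comp_ofEquiv] at this

end SetOperad

/-! ### Finite products of isomorphism classes -/

namespace PosetClass

theorem mk_pi_fin : ∀ {n : ℕ} (A : Fin n → Type u) [∀ i, PartialOrder (A i)],
    mk (∀ i, A i) = ∏ i, mk (A i)
  | 0, A, _ => (mk_eq_mk (Q' := PUnit)
      { toFun := fun _ => PUnit.unit
        invFun := fun _ i => i.elim0
        left_inv := fun _ => Subsingleton.elim _ _
        right_inv := fun _ => rfl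
        map_rel_iff' := iff_of_true le_rfl fun i => i.elim0 })
  | n + 1, A, _ => by
    rw [Fin.prod_univ_succ, ← mk_pi_fin, mk_mul_mk]
    exact (mk_eq_mk (Fin.consOrderIso A)).symm

theorem mk_pi {ι : Type} [Fintype ι] (A : ι → Type u) [∀ i, PartialOrder (A i)] :
    mk (∀ i, A i) = ∏ i, mk (A i) := by
  let e := Fintype.equivFin ι
  rw [← e.symm.prod_comp, ← mk_pi_fin]
  refine mk_eq_mk { toEquiv := Equiv.piCongrLeft' A e, map_rel_iff' := fun {a b} => ?_ }
  refine ⟨fun h i => ?_, fun h i => h _⟩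
  obtain ⟨j, rfl⟩ := e.symm.surjective i
  exact h j

end PosetClass

/-! ### Initial intervals: restriction to parts and gluing -/

namespace SetOperad

variable {P : SetOperad.{u}}

/-- A fibre of `f`, as a fibre of the restriction of `f` to a fibre of a coarser map. -/
def fibRestrict {A B L : Type} {f : A → B} {h : B → L} {g : A → L} (hg : ∀ a, h (f a) = g a)
    (l : L) (k : {b // h b = l}) :
    {a // f a = k.1} ≃
      {a : {a // g a = l} // (⟨f a.1, (hg a.1).trans a.2⟩ : {b // h b = l}) = k} where
  toFun a := ⟨⟨a.1, by rw [← hg, a.2, k.2]⟩, Subtype.ext a.2⟩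
  invFun a := ⟨a.1.1, congrArg Subtype.val a.2⟩
  left_inv _ := rfl
  right_inv _ := rfl

namespace Dec

variable {I L : Type} [Finite I] {g : I → L}

/-- The restriction of a decomposition to a part of a coarser partition. -/
abbrev restrict (z : P.Dec I) {h : z.K → L} (hg : ∀ i, h (z.f i) = g i) (l : L) :
    P.Dec {i // g i = l} :=
  ⟨{k // h k = l}, inferInstance, fun i => ⟨z.f i.1, (hg i.1).trans i.2⟩, fun k =>
    P.map (fibRestrict hg l k) (z.y k.1)⟩

/-- Comparison maps over the fibres of a coarser map patch together because these fibres partition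
the parts. Conversely, a global comparison respects the projections to `L`, since every part
contains a point. -/
theorem restrict_le_restrict [P.IsAugmented] {z z' : P.Dec I} {h : z.K → L} {h' : z'.K → L}
    (hg : ∀ i, h (z.f i) = g i) (hg' : ∀ i, h' (z'.f i) = g i) :
    (∀ l, z.restrict hg l ≤ z'.restrict hg' l) ↔ z ≤ z' := by
  constructor
  · intro H
    choose κ hκ H using H
    let κ' : z.K → z'.K := fun k => (κ (h k) ⟨k, rfl⟩).1
    have key : ∀ l (t : {k // h k = l}), (κ l t).1 = κ' t.1 := by
      rintro l ⟨k, rfl⟩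
      rfl
    have hκ' : ∀ i, κ' (z.f i) = z'.f i := fun i =>
      (key _ ⟨z.f i, hg i⟩).symm.trans (congrArg Subtype.val (hκ (g i) ⟨i, rfl⟩))
    refine ⟨κ', hκ', fun k' => ?_⟩
    obtain ⟨θ, hθ⟩ := H (h' k') ⟨k', rfl⟩
    let e : {t : {k // h k = h' k'} // κ (h' k') t = ⟨k', rfl⟩} ≃ {k // κ' k = k'} :=
      { toFun := fun t => ⟨t.1.1, (key _ t.1).symm.trans (congrArg Subtype.val t.2)⟩
        invFun := fun k => ⟨⟨k.1, (κ (h k.1) ⟨k.1, rfl⟩).2.symm.trans (congrArg h' k.2)⟩,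
          Subtype.ext ((key _ _).trans k.2)⟩
        left_inv := fun _ => rfl
        right_inv := fun _ => rfl }
    refine ⟨P.map e θ, map_injective (fibRestrict hg' (h' k') ⟨k', rfl⟩) (Eq.trans ?_ hθ)⟩
    rw [← P.map_trans]
    refine (map_comp_map_left _ e θ fun k => z.y k.1).trans ?_
    refine Eq.symm ((map_comp_map_right _
      (fun t : {t : {k // h k = h' k'} // κ (h' k') t = ⟨k', rfl⟩} =>
        fibRestrict hg (h' k') t.1) θ (fun t => z.y t.1.1)).trans ?_)
    exact map_congr (fun _ => rfl) _
  · rintro ⟨κ, hκ, H⟩ l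
    have hh : ∀ k, h' (κ k) = h k := fun k => by
      obtain ⟨i, rfl⟩ := z.surj k
      rw [hκ, hg, hg']
    refine ⟨fun k => ⟨κ k.1, (hh _).trans k.2⟩, fun i => Subtype.ext (hκ _), fun k' => ?_⟩
    obtain ⟨θ, hθ⟩ := H k'.1
    refine ⟨P.map (fibRestrict hh l k') θ, ?_⟩
    refine (map_comp_map_left _ _ _ _).trans ?_
    refine (map_comp_map_right _ (fun t : {k // κ k = k'.1} =>
      fibRestrict hg l ((fibRestrict hh l k') t).1) θ (fun t => z.y t.1)).trans ?_
    refine Eq.trans ?_ (congrArg (P.map (fibRestrict hg' l k')) hθ)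
    exact P.map_trans (fibComp hκ k'.1) (fibRestrict hg' l k') (P.comp θ fun t => z.y t.1)

/-- The index is quantified separately from the point so that `g i = l` can be eliminated by `rfl`;
this removes the casts from gluing. -/
theorem glue_apply (w : ∀ l, P.Dec {i // g i = l}) : ∀ l (i : {i // g i = l}),
    (⟨g i.1, (w (g i.1)).f ⟨i.1, rfl⟩⟩ : Σ l, (w l).K) = ⟨l, (w l).f i⟩ := by
  rintro l ⟨i, rfl⟩
  rfl

/-- The parts of a glued decomposition. -/
def glueFib (w : ∀ l, P.Dec {i // g i = l}) (p : Σ l, (w l).K) :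
    {i // (w p.1).f i = p.2} ≃ {i // (⟨g i, (w (g i)).f ⟨i, rfl⟩⟩ : Σ l, (w l).K) = p} where
  toFun i := ⟨i.1.1, (glue_apply w p.1 i.1).trans (congrArg (Sigma.mk p.1) i.2)⟩
  invFun i := ⟨⟨i.1, congrArg Sigma.fst i.2⟩, eq_of_heq (Sigma.ext_iff.1
    ((glue_apply w p.1 ⟨i.1, congrArg Sigma.fst i.2⟩).symm.trans i.2)).2⟩
  left_inv _ := rfl
  right_inv _ := rfl

/-- The decomposition obtained from a decomposition of each fibre of `g`. -/
abbrev glue [Finite L] (w : ∀ l, P.Dec {i // g i = l}) : P.Dec I where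
  K := Σ l, (w l).K
  fin := inferInstance
  f i := ⟨g i, (w (g i)).f ⟨i, rfl⟩⟩
  y p := P.map (glueFib w p) ((w p.1).y p.2)

theorem restrict_glue [Finite L] (w : ∀ l, P.Dec {i // g i = l}) (l : L) :
    (glue w).restrict (h := fun p => p.1) (fun _ => rfl) l ≤ w l ∧
      w l ≤ (glue w).restrict (h := fun p => p.1) (fun _ => rfl) l := by
  let b : (w l).K ≃ {p : Σ l, (w l).K // p.1 = l} :=
    { toFun := fun k => ⟨⟨l, k⟩, rfl⟩
      invFun := fun p => p.2 ▸ p.1.2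
      left_inv := fun _ => rfl
      right_inv := by rintro ⟨⟨_, k⟩, rfl⟩; rfl }
  have hb : ∀ i : {i // g i = l}, b ((w l).f i) =
      ⟨⟨g i.1, (w (g i.1)).f ⟨i.1, rfl⟩⟩, i.2⟩ := by
    rintro ⟨i, rfl⟩
    rfl
  have H : ∀ k, P.map (Equiv.subtypeEquivRight fun i =>
      ⟨fun hi => (hb i).symm.trans (congrArg b hi), fun hi => b.injective ((hb i).trans hi)⟩)
      ((w l).y k) = ((glue w).restrict (h := fun p => p.1) (fun _ => rfl) l).y (b k) :=
    fun k => P.map_trans (glueFib w ⟨l, k⟩) (fibRestrict _ l (b k)) ((w l).y k)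
  exact ⟨ge_of_equiv b hb H, le_of_equiv b hb H⟩

theorem restrict_le_single {z d : P.Dec I} {h : z.K → d.K} (hg : ∀ i, h (z.f i) = d.f i)
    (H : ∀ l, ∃ θ : P.obj {k // h k = l},
      P.map (fibComp hg l) (P.comp θ fun t => z.y t.1) = d.y l) (l : d.K) :
    z.restrict hg l ≤ single (d.y l) := by
  obtain ⟨θ, hθ⟩ := H l
  rw [le_single_iff]
  refine ⟨θ, Eq.trans ?_ hθ⟩
  exact map_comp_map_right _ (fun t : {k // h k = l} => fibRestrict hg l t) θ _

/-- With `restrict_le_single`, this says that refining `d` means choosing, independently for each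
part, something below the element on that part. -/
theorem glue_le (d : P.Dec I) (w : ∀ l, P.Dec {i // d.f i = l}) (H : ∀ l, w l ≤ single (d.y l)) :
    glue w ≤ d := by
  refine ⟨fun p => p.1, fun _ => rfl, fun l => ?_⟩
  obtain ⟨θ, hθ⟩ := le_single_iff.1 (H l)
  let b : (w l).K ≃ {p : Σ l, (w l).K // p.1 = l} :=
    { toFun := fun k => ⟨⟨l, k⟩, rfl⟩
      invFun := fun p => p.2 ▸ p.1.2
      left_inv := fun _ => rfl
      right_inv := by rintro ⟨⟨_, k⟩, rfl⟩; rfl }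
  refine ⟨P.map b θ, ?_⟩
  refine (map_comp_map_left _ b θ fun p => (glue w).y p.1).trans (Eq.trans ?_ hθ)
  refine (map_comp_map_right _ (fun k => glueFib w ⟨l, k⟩) θ (w l).y).trans ?_
  refine map_congr (fun p => ?_) _
  rfl

variable [P.IsAugmented]

/-- An initial interval of `Π_P(I)` is the product of the intervals of the inner composition
factors. -/
noncomputable def restrictIso (d : P.Dec I) :
    Set.Icc (PiElem.zero P I) d.toPi ≃o
      ∀ l, Set.Icc (PiElem.zero P {i // d.f i = l}) (PiElem.single (d.y l)) :=
  have hd : ∀ z : Set.Icc (PiElem.zero P I) d.toPi, ofPi z.1 ≤ d := fun z => ofPi_le_iff.2 z.2.2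
  RelIso.ofSurjective (OrderEmbedding.ofMapLEIff
    (fun z l => ⟨((ofPi z.1).restrict (hd z).choose_spec.choose l).toPi, PiElem.zero_le _, by
      rw [← toPi_single, toPi_le_toPi]
      exact restrict_le_single _ (hd z).choose_spec.choose_spec l⟩)
    (fun z z' => by
      rw [Pi.le_def]
      simp only [Subtype.mk_le_mk, toPi_le_toPi]
      rw [restrict_le_restrict, ofPi_le_ofPi, Subtype.coe_le_coe])) (by
    intro w
    have hw : glue (fun l => ofPi (w l).1) ≤ d := by
      refine glue_le d _ fun l => ?_
      rw [ofPi_le_iff, toPi_single]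
      exact (w l).2.2
    let z : Set.Icc (PiElem.zero P I) d.toPi :=
      ⟨(glue fun l => ofPi (w l).1).toPi, PiElem.zero_le _, toPi_le_toPi.2 hw⟩
    refine ⟨z, funext fun l => Subtype.ext ?_⟩
    have h1 := restrict_glue (fun l => ofPi (w l).1) l
    -- The order embedding uses a chosen comparison map, which need not be visibly the projection of
    -- the glued decomposition. The claim is therefore proved for every comparison map; restrictions
    -- along different ones are compared by `restrict_le_restrict`.
    have key : ∀ {h : (ofPi z.1).K → d.K} (hg : ∀ i, h ((ofPi z.1).f i) = d.f i),
        ((ofPi z.1).restrict hg l).toPi = (w l).1 := fun hg =>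
      le_antisymm (le_ofPi_iff.1 (((restrict_le_restrict hg _).2 (toPi_le _) l).trans h1.1))
        (ofPi_le_iff.1 (h1.2.trans ((restrict_le_restrict _ hg).2 (le_toPi _) l)))
    exact key _)

end Dec

theorem mk_Icc_toPi [P.IsAugmented] {I : Type} [Finite I] (d : P.Dec I) [Fintype d.K] :
    PosetClass.mk (Set.Icc (PiElem.zero P I) d.toPi) = ∏ l, ivl (d.y l) :=
  (PosetClass.mk_eq_mk d.restrictIso).trans (PosetClass.mk_pi _)

end SetOperad

/-! ### Coinvariants and the classes of intervals -/

namespace SetOperad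

variable {P : SetOperad.{u}} {I J : Type} [Finite I] [Finite J]

theorem cls_eq_mk {n : ℕ} (e : I ≃ Fin n) (x : P.obj I) :
    cls x = ⟨n, Quotient.mk _ (P.map e x)⟩ := by
  obtain rfl : Nat.card I = n := by rw [Nat.card_congr e, Nat.card_fin]
  refine congrArg (Sigma.mk _) (Quotient.sound ⟨(Finite.equivFin I).symm.trans e, ?_⟩)
  rw [P.map_trans, map_symm_map]

theorem cls_eq_cls_iff {x : P.obj I} {y : P.obj J} :
    cls x = cls y ↔ ∃ e : I ≃ J, P.map e x = y := by
  constructor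
  · intro h
    have hc : Nat.card I = Nat.card J := congrArg Sigma.fst h
    let e : J ≃ Fin (Nat.card I) := (Finite.equivFin J).trans (finCongr hc.symm)
    rw [cls_eq_mk e y] at h
    obtain ⟨σ, hσ⟩ := Quotient.exact
      (sigma_mk_injective (β := fun n => Quotient (P.orbitSetoid n)) h)
    refine ⟨((Finite.equivFin I).trans σ).trans e.symm, ?_⟩
    rw [P.map_trans, P.map_trans, hσ, map_symm_map]
  · rintro ⟨e, rfl⟩
    rw [cls_eq_mk (Finite.equivFin J) (P.map e x), ← P.map_trans]
    exact cls_eq_mk _ x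

theorem cls_map (e : I ≃ J) (x : P.obj I) : cls (P.map e x) = cls x :=
  (cls_eq_cls_iff.2 ⟨e, rfl⟩).symm

theorem cls_rep (α : P.Coinv) : cls α.rep = α := by
  rw [cls_eq_mk (Equiv.refl _), P.map_refl]
  exact congrArg (Sigma.mk α.1) (Quotient.out_eq α.2)

theorem exists_map_rep (x : P.obj I) : ∃ e : Fin (cls x).arity ≃ I, P.map e (cls x).rep = x :=
  cls_eq_cls_iff.1 (cls_rep _)

theorem arity_cls (x : P.obj I) : (cls x).arity = Nat.card I := rfl

theorem cls_eq_iff {x : P.obj I} {α : P.Coinv} :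
    cls x = α ↔ ∃ e : Fin α.arity ≃ I, P.map e α.rep = x := by
  rw [← cls_eq_cls_iff, cls_rep, eq_comm]

theorem arity_one : P.one.arity = 1 := by
  rw [one, arity_cls, Nat.card_unique]

theorem cls_comp_map (x : P.obj I) {K L : I → Type} [∀ i, Finite (K i)] [∀ i, Finite (L i)]
    (y : ∀ i, P.obj (K i)) (z : ∀ i, P.obj (L i)) (h : ∀ i, cls (y i) = cls (z i)) :
    cls (P.comp x y) = cls (P.comp x z) := by
  choose e he using fun i => cls_eq_cls_iff.1 (h i)
  rw [← cls_map (Equiv.sigmaCongrRight e), ← P.comp_map_right]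
  simp only [he]

theorem arity_comp (x : P.obj I) [Fintype I] {K : I → Type} [∀ i, Finite (K i)]
    (y : ∀ i, P.obj (K i)) : (cls (P.comp x y)).arity = ∑ i, (cls (y i)).arity := by
  rw [arity_cls, Nat.card_sigma]
  rfl

section Augmented

variable [P.IsAugmented]

theorem nonempty_of_obj (x : P.obj I) : Nonempty I := by
  by_contra h
  rw [not_nonempty_iff] at h
  exact (IsAugmented.isEmpty (P := P) I).false x

theorem arity_pos (α : P.Coinv) : 0 < α.arity := by
  obtain ⟨i⟩ := nonempty_of_obj α.rep
  exact i.pos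

theorem subsingleton_obj [Unique I] : Subsingleton (P.obj I) := by
  obtain ⟨h⟩ := IsAugmented.unique (P := P) I
  infer_instance

/-- In an augmented operad the unit is the only element over a singleton, so $\varepsilon$ is
recognised by its arity. -/
theorem cls_eq_one_iff {x : P.obj I} : cls x = P.one ↔ Nat.card I = 1 := by
  constructor
  · intro h
    rw [← arity_cls x, h, arity_one]
  · intro h
    obtain ⟨h1, h2⟩ := Nat.card_eq_one_iff_unique.1 h
    have : Unique I := Classical.choice ((unique_iff_subsingleton_and_nonempty I).2 ⟨h1, h2⟩)
    have := subsingleton_obj (P := P) (I := I)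
    exact (cls_eq_cls_iff.2 ⟨Equiv.ofUnique Unit I, Subsingleton.elim _ _⟩).symm

theorem eq_one_iff {α : P.Coinv} : α = P.one ↔ α.arity = 1 := by
  conv_lhs => rw [← cls_rep α]
  rw [cls_eq_one_iff, Nat.card_fin]

theorem ivl_eq (hP : P.IsBasic) (x : P.obj I) : ivl x = PosetClass.mk (cls x).Interval := by
  obtain ⟨e, he⟩ := exists_map_rep x
  rw [← he, ivl_map hP, he]
  rfl

theorem ivl_mem (hP : P.IsBasic) (x : P.obj I) : ivl x ∈ P.intervalClasses := by
  rw [ivl_eq hP]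
  exact Submonoid.subset_closure ⟨_, rfl⟩

/-- The outer composition factor of `y` relative to a smaller element of `Π_P(I)`. -/
theorem PiElem.exists_of_le_single {x : P.PiElem I} {y : P.obj I} (h : x ≤ PiElem.single y) :
    ∃ θ : P.obj (Quotient x.part), P.map (Equiv.sigmaFiberEquiv _) (P.comp θ x.el) = y := by
  rw [← Dec.toPi_single, ← Dec.ofPi_le_iff, Dec.le_single_iff] at h
  exact h

theorem mk_Icc_zero (x : P.PiElem I) [Fintype (Quotient x.part)] :
    PosetClass.mk (Set.Icc (PiElem.zero P I) x) = ∏ q, ivl (x.el q) := by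
  have := mk_Icc_toPi (Dec.ofPi x)
  rwa [Dec.toPi_ofPi] at this

theorem mk_Icc_single (hP : P.IsBasic) {x : P.PiElem I} {y : P.obj I}
    {θ : P.obj (Quotient x.part)} (h : P.map (Equiv.sigmaFiberEquiv _) (P.comp θ x.el) = y) :
    PosetClass.mk (Set.Icc x (PiElem.single y)) = ivl θ := by
  subst h
  have := mk_Icc_compose hP (Dec.ofPi x) θ
  rwa [Dec.toPi_ofPi] at this

end Augmented

end SetOperad

/-! ### Heredity of the family of interval classes -/

namespace PosetClass

theorem mk_eq_mk_iff {Q Q' : Type u} [PartialOrder Q] [PartialOrder Q'] :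
    mk Q = mk Q' ↔ Nonempty (Q ≃o Q') :=
  ⟨Quotient.exact, fun ⟨e⟩ => mk_eq_mk e⟩

theorem mk_Iic_Icc {A : Type u} [PartialOrder A] {a b : A} (x : Set.Icc a b) :
    mk (Set.Iic x) = mk (Set.Icc a x.1) :=
  mk_eq_mk
    { toFun := fun z => ⟨z.1.1, z.1.2.1, z.2⟩
      invFun := fun z => ⟨⟨z.1, z.2.1, z.2.2.trans x.2.2⟩, z.2.2⟩
      left_inv := fun _ => rfl
      right_inv := fun _ => rfl
      map_rel_iff' := Iff.rfl }

theorem mk_Ici_Icc {A : Type u} [PartialOrder A] {a b : A} (x : Set.Icc a b) :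
    mk (Set.Ici x) = mk (Set.Icc x.1 b) :=
  mk_eq_mk
    { toFun := fun z => ⟨z.1.1, z.2, z.1.2.2⟩
      invFun := fun z => ⟨⟨z.1, x.2.1.trans z.2.1, z.2.2⟩, z.2.1⟩
      left_inv := fun _ => rfl
      right_inv := fun _ => rfl
      map_rel_iff' := Iff.rfl }

/-- Initial intervals of isomorphic posets. -/
def IicIso {Q Q' : Type u} [PartialOrder Q] [PartialOrder Q'] (e : Q ≃o Q') (x : Q) :
    Set.Iic x ≃o Set.Iic (e x) where
  toEquiv := e.toEquiv.subtypeEquiv fun _ => e.le_iff_le.symm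
  map_rel_iff' := e.le_iff_le

/-- Final intervals of isomorphic posets. -/
def IciIso {Q Q' : Type u} [PartialOrder Q] [PartialOrder Q'] (e : Q ≃o Q') (x : Q) :
    Set.Ici x ≃o Set.Ici (e x) where
  toEquiv := e.toEquiv.subtypeEquiv fun _ => e.le_iff_le.symm
  map_rel_iff' := e.le_iff_le

theorem mk_Iic_prod {Q Q' : Type u} [PartialOrder Q] [PartialOrder Q'] (x : Q × Q') :
    mk (Set.Iic x) = mk (Set.Iic x.1) * mk (Set.Iic x.2) :=
  mk_eq_mk
    { toFun := fun z => (⟨z.1.1, z.2.1⟩, ⟨z.1.2, z.2.2⟩)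
      invFun := fun z => ⟨(z.1.1, z.2.1), z.1.2, z.2.2⟩
      left_inv := fun _ => rfl
      right_inv := fun _ => rfl
      map_rel_iff' := Iff.rfl }

theorem mk_Ici_prod {Q Q' : Type u} [PartialOrder Q] [PartialOrder Q'] (x : Q × Q') :
    mk (Set.Ici x) = mk (Set.Ici x.1) * mk (Set.Ici x.2) :=
  mk_eq_mk
    { toFun := fun z => (⟨z.1.1, z.2.1⟩, ⟨z.1.2, z.2.2⟩)
      invFun := fun z => ⟨(z.1.1, z.2.1), z.1.2, z.2.2⟩
      left_inv := fun _ => rfl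
      right_inv := fun _ => rfl
      map_rel_iff' := Iff.rfl }

theorem mk_Iic_one (x : PUnit.{u + 1}) : mk (Set.Iic x) = 1 :=
  mk_eq_mk (Q' := PUnit)
    { toFun := fun _ => x
      invFun := fun _ => ⟨x, le_refl x⟩
      left_inv := fun _ => Subsingleton.elim _ _
      right_inv := fun _ => Subsingleton.elim _ _
      map_rel_iff' := iff_of_true le_rfl (Subsingleton.elim _ _).le }

theorem mk_Ici_one (x : PUnit.{u + 1}) : mk (Set.Ici x) = 1 :=
  mk_eq_mk (Q' := PUnit)
    { toFun := fun _ => x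
      invFun := fun _ => ⟨x, le_refl x⟩
      left_inv := fun _ => Subsingleton.elim _ _
      right_inv := fun _ => Subsingleton.elim _ _
      map_rel_iff' := iff_of_true le_rfl (Subsingleton.elim _ _).le }

end PosetClass

/-- A family of posets generated under products by finite bounded posets is hereditary if it
contains the initial and final intervals of its generators. -/
theorem isHereditary_closure {s : Set PosetClass.{u}}
    (hfin : ∀ (Q : Type u) [PartialOrder Q], PosetClass.mk Q ∈ s → Finite Q)
    (hbot : ∀ (Q : Type u) [PartialOrder Q], PosetClass.mk Q ∈ s → ∃ b : Q, IsBot b)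
    (htop : ∀ (Q : Type u) [PartialOrder Q], PosetClass.mk Q ∈ s → ∃ b : Q, IsTop b)
    (hIic : ∀ (Q : Type u) [PartialOrder Q], PosetClass.mk Q ∈ s →
      ∀ x : Q, PosetClass.mk (Set.Iic x) ∈ Submonoid.closure s)
    (hIci : ∀ (Q : Type u) [PartialOrder Q], PosetClass.mk Q ∈ s →
      ∀ x : Q, PosetClass.mk (Set.Ici x) ∈ Submonoid.closure s) :
    IsHereditary (Submonoid.closure s) := by
  -- The claim ranges over all posets of the class `c`, so that the induction on the closure can
  -- pass to an explicit product of representatives.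
  have key : ∀ c ∈ Submonoid.closure s, ∀ (Q : Type u) [PartialOrder Q], PosetClass.mk Q = c →
      Finite Q ∧ (∃ b : Q, IsBot b) ∧ (∃ b : Q, IsTop b) ∧
      ∀ x : Q, PosetClass.mk (Set.Iic x) ∈ Submonoid.closure s ∧
        PosetClass.mk (Set.Ici x) ∈ Submonoid.closure s := by
    intro c hc
    induction hc using Submonoid.closure_induction with
    | mem c hc =>
      rintro Q _ rfl
      exact ⟨hfin Q hc, hbot Q hc, htop Q hc, fun x => ⟨hIic Q hc x, hIci Q hc x⟩⟩
    | one =>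
      intro Q _ hQ
      obtain ⟨e⟩ := PosetClass.mk_eq_mk_iff.1 (show _ = PosetClass.mk PUnit from hQ)
      refine ⟨.of_equiv _ e.symm.toEquiv, ⟨e.symm ⟨⟩, fun x => ?_⟩, ⟨e.symm ⟨⟩, fun x => ?_⟩,
        fun x => ?_⟩
      · exact (e.injective (Subsingleton.elim _ _)).le
      · exact (e.injective (Subsingleton.elim _ _)).le
      · rw [PosetClass.mk_eq_mk (PosetClass.IicIso e x), PosetClass.mk_eq_mk
          (PosetClass.IciIso e x), PosetClass.mk_Iic_one, PosetClass.mk_Ici_one]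
        exact ⟨one_mem _, one_mem _⟩
    | mul a b ha hb iha ihb =>
      intro Q _ hQ
      induction a using PosetClass.ind_mk with | h A =>
      induction b using PosetClass.ind_mk with | h B =>
      obtain ⟨e⟩ := PosetClass.mk_eq_mk_iff.1 (hQ.trans (PosetClass.mk_mul_mk A B))
      obtain ⟨h1, ⟨b1, hb1⟩, ⟨t1, ht1⟩, hI1⟩ := iha A rfl
      obtain ⟨h2, ⟨b2, hb2⟩, ⟨t2, ht2⟩, hI2⟩ := ihb B rfl
      refine ⟨.of_equiv _ e.symm.toEquiv, ⟨e.symm (b1, b2), fun x => ?_⟩,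
        ⟨e.symm (t1, t2), fun x => ?_⟩, fun x => ?_⟩
      · rw [e.symm_apply_le]
        exact ⟨hb1 _, hb2 _⟩
      · rw [e.le_symm_apply]
        exact ⟨ht1 _, ht2 _⟩
      · rw [PosetClass.mk_eq_mk (PosetClass.IicIso e x), PosetClass.mk_eq_mk
          (PosetClass.IciIso e x), PosetClass.mk_Iic_prod, PosetClass.mk_Ici_prod]
        exact ⟨mul_mem (hI1 _).1 (hI2 _).1, mul_mem (hI1 _).2 (hI2 _).2⟩
  exact ⟨fun Q _ h => (key _ h Q rfl).1, fun Q _ h => (key _ h Q rfl).2.1,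
    fun Q _ h => (key _ h Q rfl).2.2.1, fun Q _ h x => ((key _ h Q rfl).2.2.2 x).1,
    fun Q _ h x => ((key _ h Q rfl).2.2.2 x).2⟩

namespace SetOperad

variable {P : SetOperad.{u}} [P.IsAugmented]

/-- An initial interval is the product of the intervals of the parts, and a final interval is the
interval of the outer factor. -/
theorem isHereditary_intervalClasses (hP : P.IsBasic) (hfin : ∀ α : P.Coinv, Finite α.Interval) :
    IsHereditary P.intervalClasses := by
  apply isHereditary_closure
  · rintro Q _ ⟨α, hα⟩
    obtain ⟨e⟩ := PosetClass.mk_eq_mk_iff.1 hα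
    have := hfin α
    exact .of_equiv _ e.toEquiv
  · rintro Q _ ⟨α, hα⟩
    obtain ⟨e⟩ := PosetClass.mk_eq_mk_iff.1 hα
    refine ⟨e ⟨_, le_rfl, PiElem.zero_le _⟩, fun x => ?_⟩
    rw [← e.le_symm_apply]
    exact PiElem.zero_le _
  · rintro Q _ ⟨α, hα⟩
    obtain ⟨e⟩ := PosetClass.mk_eq_mk_iff.1 hα
    refine ⟨e ⟨_, PiElem.zero_le _, le_rfl⟩, fun x => ?_⟩
    rw [← e.symm_apply_le]
    exact (e.symm x).2.2
  · rintro Q _ ⟨α, hα⟩ x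
    obtain ⟨e⟩ := PosetClass.mk_eq_mk_iff.1 hα
    classical
    have := Fintype.ofFinite (Quotient (e.symm x).1.part)
    rw [PosetClass.mk_eq_mk (PosetClass.IicIso e.symm x), PosetClass.mk_Iic_Icc, mk_Icc_zero]
    exact Submonoid.prod_mem _ fun q _ => ivl_mem hP _
  · rintro Q _ ⟨α, hα⟩ x
    obtain ⟨e⟩ := PosetClass.mk_eq_mk_iff.1 hα
    obtain ⟨θ, hθ⟩ := PiElem.exists_of_le_single (e.symm x).2.2
    rw [PosetClass.mk_eq_mk (PosetClass.IciIso e.symm x), PosetClass.mk_Ici_Icc,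
      mk_Icc_single hP hθ]
    exact ivl_mem hP _

end SetOperad

/-! ### Double counting of labelled composites -/

namespace SetOperad

variable {P : SetOperad.{u}} {I J : Type} [Finite I] [Finite J]

/-- The isomorphisms between two elements of an operad. -/
abbrev Isos (x : P.obj I) (y : P.obj J) : Type := {e : I ≃ J // P.map e x = y}

/-- Fixed isomorphisms of `x` and `y` with the representative identify these isomorphisms with its
stabilizer. -/
theorem card_isos {x : P.obj I} {y : P.obj J} (h : cls x = cls y) :
    Nat.card (Isos x y) = (cls y).cardAut := by
  obtain ⟨e, he⟩ := cls_eq_iff.1 h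
  obtain ⟨e', he'⟩ := exists_map_rep y
  refine Nat.card_congr (((Equiv.equivCongr e.symm e'.symm).subtypeEquiv fun a => ?_))
  rw [show Equiv.equivCongr e.symm e'.symm a = (e.trans a).trans e'.symm from rfl, P.map_trans,
    P.map_trans, he, ← (map_injective e').eq_iff, map_map_symm, he']

theorem cardAut_ne_zero (α : P.Coinv) : α.cardAut ≠ 0 := by
  have : Nonempty {σ : Equiv.Perm (Fin α.arity) // P.map σ α.rep = α.rep} :=
    ⟨⟨Equiv.refl _, P.map_refl _⟩⟩
  exact Nat.card_pos.ne'

/-- The presentations of an element by a relabelling of the chosen representative of its class. -/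
abbrev Label (x : P.obj I) : Type u :=
  {p : Σ α : P.Coinv, (Fin α.arity ≃ I) // P.map p.2 p.1.rep = x}

theorem Label.cls_eq {x : P.obj I} (p : Label x) : p.1.1 = cls x := by
  rw [← cls_rep p.1.1, ← cls_map p.1.2, p.2]

/-- A label of `x` is an isomorphism onto `x`. -/
noncomputable def labelEquiv (x : P.obj I) : Label x ≃ Isos (cls x).rep x where
  toFun p := ⟨(finCongr (congrArg _ p.cls_eq.symm)).trans p.1.2, by
    obtain ⟨⟨α, e⟩, h⟩ := p
    obtain rfl : α = cls x := Label.cls_eq ⟨⟨α, e⟩, h⟩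
    exact h⟩
  invFun e := ⟨⟨cls x, e.1⟩, e.2⟩
  left_inv p := by
    obtain ⟨⟨α, e⟩, h⟩ := p
    obtain rfl : α = cls x := Label.cls_eq ⟨⟨α, e⟩, h⟩
    rfl
  right_inv _ := rfl

theorem card_label (x : P.obj I) : Nat.card (Label x) = (cls x).cardAut := by
  rw [Nat.card_congr (labelEquiv x), card_isos (cls_rep _)]

instance (x : P.obj I) : Finite (Label x) := .of_equiv _ (labelEquiv x).symm

/-- A class together with a class for each input. -/
abbrev Tree (P : SetOperad.{u}) : Type u := Σ a : P.Coinv, (Fin a.arity → P.Coinv)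

/-- The composite of the representatives. -/
noncomputable abbrev Tree.comp (t : P.Tree) : P.obj (Σ i, Fin (t.2 i).arity) :=
  P.comp t.1.rep fun i => (t.2 i).rep

/-- The presentations of an element as a composite of representatives. -/
abbrev TreeLabel (y : P.obj I) : Type u := Σ t : P.Tree, Isos t.comp y

/-- The number of automorphisms of the vertices of a tree. -/
noncomputable def Tree.weight (t : P.Tree) : ℕ := t.1.cardAut * ∏ i, (t.2 i).cardAut

/-- The bijection underlying `treeLabel`. -/
noncomputable def treeEquiv {I : Type} {r : Setoid I} {a : P.Coinv} (ψ : Fin a.arity ≃ Quotient r)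
    {b : Fin a.arity → P.Coinv} (χ : ∀ i, Fin (b i).arity ≃ {j // Quotient.mk r j = ψ i}) :
    (Σ i, Fin (b i).arity) ≃ I :=
  ((Equiv.sigmaCongrRight χ).trans (Equiv.sigmaCongrLeft
    (β := fun q => {j // Quotient.mk r j = q}) ψ)).trans (Equiv.sigmaFiberEquiv _)

theorem treeEquiv_apply {I : Type} {r : Setoid I} {a : P.Coinv} (ψ : Fin a.arity ≃ Quotient r)
    {b : Fin a.arity → P.Coinv} (χ : ∀ i, Fin (b i).arity ≃ {j // Quotient.mk r j = ψ i})
    (i : Fin a.arity) (k : Fin (b i).arity) : treeEquiv ψ χ ⟨i, k⟩ = (χ i k).1 := rfl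

theorem map_treeEquiv {r : Setoid I} {a : P.Coinv} (ψ : Fin a.arity ≃ Quotient r)
    {b : Fin a.arity → P.Coinv} (χ : ∀ i, Fin (b i).arity ≃ {j // Quotient.mk r j = ψ i})
    (el : ∀ q, P.obj {j // Quotient.mk r j = q}) (hχ : ∀ i, P.map (χ i) (b i).rep = el (ψ i)) :
    P.map (treeEquiv ψ χ) (Tree.comp ⟨a, b⟩) =
      P.map (Equiv.sigmaFiberEquiv _) (P.comp (P.map ψ a.rep) el) := by
  rw [treeEquiv, P.map_trans, P.map_trans, ← P.comp_map_right, P.comp_map_left]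
  simp only [hχ]

variable [P.IsAugmented]

/-- The outer composition factor of `y` over an element of `Π_P(I)` below `y`. -/
noncomputable def outer {y : P.obj I} (x : Set.Icc (PiElem.zero P I) (PiElem.single y)) :
    P.obj (Quotient x.1.part) :=
  (PiElem.exists_of_le_single x.2.2).choose

theorem comp_outer {y : P.obj I} (x : Set.Icc (PiElem.zero P I) (PiElem.single y)) :
    P.map (Equiv.sigmaFiberEquiv _) (P.comp (outer x) x.1.el) = y :=
  (PiElem.exists_of_le_single x.2.2).choose_spec

/-- The labels of the composition factors of `y` over an element of `Π_P(I)` below `y`. -/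
abbrev FactorLabel {y : P.obj I} (x : Set.Icc (PiElem.zero P I) (PiElem.single y)) : Type u :=
  Σ A : Label (outer x), ∀ i, Label (x.1.el (A.1.2 i))

/-- The label of a composite obtained from labels of the composition factors. -/
noncomputable def treeLabel {y : P.obj I}
    (D : Σ x : Set.Icc (PiElem.zero P I) (PiElem.single y), FactorLabel x) : TreeLabel y :=
  ⟨⟨D.2.1.1.1, fun i => (D.2.2 i).1.1⟩, treeEquiv D.2.1.1.2 fun i => (D.2.2 i).1.2,
    (map_treeEquiv _ _ _ fun i => (D.2.2 i).2).trans (by rw [D.2.1.2, comp_outer])⟩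

/-- The total bijection sends `(i, k)` to `χ i k`. Two points are therefore equivalent exactly when
their first coordinates agree, which recovers the partition; `ψ i` is the class of `χ i 0`, which
exists because arities are positive; the elements on the parts are the relabelled representatives.
-/
theorem treeLabel_injective {y : P.obj I} : Function.Injective (treeLabel (y := y)) := by
  rintro ⟨⟨⟨r, el⟩, hx⟩, ⟨⟨a, ψ⟩, hψ⟩, B⟩ ⟨⟨⟨r', el'⟩, hx'⟩, ⟨⟨a', ψ'⟩, hψ'⟩, B'⟩ h
  obtain ⟨b, χ, hχ, rfl⟩ : ∃ (b : Fin a.arity → P.Coinv)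
      (χ : ∀ i, Fin (b i).arity ≃ {j // Quotient.mk r j = ψ i})
      (hχ : ∀ i, P.map (χ i) (b i).rep = el (ψ i)), B = fun i => ⟨⟨b i, χ i⟩, hχ i⟩ :=
    ⟨fun i => (B i).1.1, fun i => (B i).1.2, fun i => (B i).2, rfl⟩
  obtain ⟨b', χ', hχ', rfl⟩ : ∃ (b : Fin a'.arity → P.Coinv)
      (χ : ∀ i, Fin (b i).arity ≃ {j // Quotient.mk r' j = ψ' i})
      (hχ : ∀ i, P.map (χ i) (b i).rep = el' (ψ' i)), B' = fun i => ⟨⟨b i, χ i⟩, hχ i⟩ :=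
    ⟨fun i => (B' i).1.1, fun i => (B' i).1.2, fun i => (B' i).2, rfl⟩
  have h0 : (⟨a, b⟩ : P.Tree) = ⟨a', b'⟩ := congrArg Sigma.fst h
  obtain ⟨rfl, h0⟩ := Sigma.mk.inj h0
  obtain rfl := eq_of_heq h0
  have h2 : treeEquiv ψ χ = treeEquiv ψ' χ' := by
    simp only [treeLabel, Sigma.mk.injEq, heq_eq_eq, true_and, Subtype.mk.injEq] at h
    exact h
  have h1 : ∀ i k, (χ i k).1 = (χ' i k).1 := fun i k => by
    rw [← treeEquiv_apply, h2, treeEquiv_apply]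
  have hr : ∀ i k, Quotient.mk r (χ i k).1 = ψ i := fun i k => (χ i k).2
  have hr' : ∀ i k, Quotient.mk r' (χ i k).1 = ψ' i := fun i k => by rw [h1]; exact (χ' i k).2
  have hs : ∀ j, ∃ i k, (χ i k).1 = j := fun j => by
    obtain ⟨i, hi⟩ := ψ.surjective (Quotient.mk r j)
    obtain ⟨k, hk⟩ := (χ i).surjective ⟨j, hi.symm⟩
    exact ⟨i, k, by rw [hk]⟩
  obtain rfl : r = r' := by
    ext j j'
    obtain ⟨i, k, rfl⟩ := hs j
    obtain ⟨i', k', rfl⟩ := hs j'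
    have e1 : r (χ i k).1 (χ i' k').1 ↔ i = i' := by
      rw [← Quotient.eq, hr, hr, ψ.apply_eq_iff_eq]
    have e2 : r' (χ i k).1 (χ i' k').1 ↔ i = i' := by
      rw [← Quotient.eq, hr', hr', ψ'.apply_eq_iff_eq]
    exact e1.trans e2.symm
  obtain rfl : ψ = ψ' := by
    ext i
    rw [← hr i ⟨0, arity_pos _⟩, ← hr' i ⟨0, arity_pos _⟩]
  obtain rfl : χ = χ' := by
    funext i
    ext k
    exact h1 i k
  obtain rfl : el = el' := by
    funext q
    obtain ⟨i, rfl⟩ := ψ.surjective q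
    exact (hχ i).symm.trans (hχ' i)
  rfl

theorem treeLabel_surjective (hP : P.IsBasic) {y : P.obj I} :
    Function.Surjective (treeLabel (y := y)) := by
  rintro ⟨⟨a, b⟩, φ, hφ⟩
  let f : I → Fin a.arity := fun j => (φ.symm j).1
  -- The partition is the image under `φ` of the blocks of inputs of the branches.
  let χ₀ : ∀ i, Fin (b i).arity ≃ {j // f j = i} := fun i =>
    (Equiv.sigmaSubtype (β := fun i => Fin (b i).arity) i).symm.trans
      (φ.subtypeEquiv fun p => by simp [f])
  let d : P.Dec I := ⟨Fin a.arity, inferInstance, f, fun i => P.map (χ₀ i) (b i).rep⟩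
  let ψ : Fin a.arity ≃ Quotient d.toPi.part := d.partsEquiv.symm
  have hψ : ∀ j, Quotient.mk d.toPi.part j = ψ (f j) := fun j =>
    (d.partsEquiv.symm_apply_apply _).symm
  let χ : ∀ i, Fin (b i).arity ≃ {j // Quotient.mk d.toPi.part j = ψ i} := fun i =>
    (χ₀ i).trans (Equiv.subtypeEquivRight fun j => by rw [hψ, ψ.apply_eq_iff_eq])
  have hχ : ∀ i, P.map (χ i) (b i).rep = d.toPi.el (ψ i) := fun i => by
    have h1 : d.partsEquiv (ψ i) = i := d.partsEquiv.apply_symm_apply i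
    have h2 : d.toPi.el (ψ i) = P.map (Equiv.subtypeEquivRight fun j => by
      rw [hψ, ψ.apply_eq_iff_eq, h1]) (d.y (d.partsEquiv (ψ i))) := rfl
    rw [h2, ← map_el_eq d.y h1.symm (Equiv.subtypeEquivRight fun j => by rw [h1]) (fun _ => rfl),
      ← P.map_trans]
    exact (map_congr (fun _ => rfl) _).trans (P.map_trans (χ₀ i) _ (b i).rep)
  have hc : P.map (Equiv.sigmaFiberEquiv _) (P.comp (P.map ψ a.rep) d.toPi.el) = y := by
    rw [P.comp_map_left]
    simp only [← hχ]
    rw [P.comp_map_right, ← P.map_trans, ← P.map_trans, ← hφ]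
    refine map_congr (fun p => ?_) _
    rfl
  have hx : d.toPi ≤ PiElem.single y := by
    rw [← Dec.toPi_single, ← Dec.ofPi_le_iff, Dec.le_single_iff]
    exact ⟨_, hc⟩
  let x : Set.Icc (PiElem.zero P I) (PiElem.single y) := ⟨d.toPi, PiElem.zero_le _, hx⟩
  -- `outer x` is only a chosen factor; basicness makes it unique.
  have ho : P.map ψ a.rep = outer x :=
    hP _ _ _ (map_injective _ (hc.trans (comp_outer x).symm))
  refine ⟨⟨x, ⟨⟨⟨a, ψ⟩, ho⟩, fun i => ⟨⟨b i, χ i⟩, hχ i⟩⟩⟩, ?_⟩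
  have he : (treeLabel ⟨x, ⟨⟨a, ψ⟩, ho⟩, fun i => ⟨⟨b i, χ i⟩, hχ i⟩⟩).2 = ⟨φ, hφ⟩ :=
    Subtype.ext (Equiv.ext fun p => rfl)
  exact Sigma.ext rfl (heq_of_eq he)

/-- Labels of a composite are the same as labels of the composition factors. -/
noncomputable def treeLabelEquiv (hP : P.IsBasic) (y : P.obj I) :
    (Σ x : Set.Icc (PiElem.zero P I) (PiElem.single y), FactorLabel x) ≃ TreeLabel y :=
  Equiv.ofBijective treeLabel ⟨treeLabel_injective, treeLabel_surjective hP⟩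

/-- The number of labels of the parts does not depend on the label of the outer factor, which merely
reindexes the parts. -/
theorem card_factorLabel {y : P.obj I} (x : Set.Icc (PiElem.zero P I) (PiElem.single y))
    [Fintype (Quotient x.1.part)] : Nat.card (FactorLabel x) =
      (cls (outer x)).cardAut * ∏ q, (cls (x.1.el q)).cardAut := by
  have := Fintype.ofFinite (Label (outer x))
  rw [Nat.card_sigma]
  simp only [Nat.card_pi, card_label]
  have h : ∀ A : Label (outer x), ∏ i, (cls (x.1.el (A.1.2 i))).cardAut =
      ∏ q, (cls (x.1.el q)).cardAut :=
    fun A => Equiv.prod_comp A.1.2 fun q => (cls (x.1.el q)).cardAut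
  simp only [h]
  rw [Finset.sum_const, ← card_label (outer x), Nat.card_eq_fintype_card, smul_eq_mul,
    Finset.card_univ]

/-- The trees with composite of class `α`. -/
abbrev TreeOf (α : P.Coinv) : Type u := {t : P.Tree // cls t.comp = α}

theorem finite_treeLabel (hP : P.IsBasic) (y : P.obj I)
    [Finite (Set.Icc (PiElem.zero P I) (PiElem.single y))] : Finite (TreeLabel y) :=
  .of_equiv _ (treeLabelEquiv hP y)

/-- Labels of a representative, sorted by the underlying tree. -/
noncomputable def treeLabelRepEquiv (α : P.Coinv) :
    TreeLabel α.rep ≃ Σ t : TreeOf α, Isos t.1.comp α.rep where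
  toFun p := ⟨⟨p.1, by rw [← cls_map p.2.1, p.2.2, cls_rep]⟩, p.2⟩
  invFun p := ⟨p.1.1, p.2⟩
  left_inv _ := rfl
  right_inv _ := rfl

/-- Every such tree has at least one label, and the labels of `α.rep` are finite in number by
`treeLabelEquiv`. This makes the products of series finite sums. -/
theorem finite_treeOf (hP : P.IsBasic) (α : P.Coinv) [Finite α.Interval] : Finite (TreeOf α) := by
  have := finite_treeLabel hP α.rep
  refine Finite.of_surjective (fun p => (treeLabelRepEquiv α p).1) fun t => ?_
  obtain ⟨e, he⟩ := cls_eq_cls_iff.1 (t.2.trans (cls_rep α).symm)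
  exact ⟨(treeLabelRepEquiv α).symm ⟨t, e, he⟩, rfl⟩

/-- Weighted sums over trees are sums over intervals of `Π_P`. -/
theorem sum_tree_eq_sum_interval (hP : P.IsBasic) (α : P.Coinv) [Fintype α.Interval]
    [Fintype (TreeOf α)] {M : Type*} [AddCommGroup M] [Module ℚ M] (W : P.Tree → M)
    (V : α.Interval → M)
    (h : ∀ (x : α.Interval) (D : FactorLabel x), W (treeLabel ⟨x, D⟩).1 = V x) :
    ∑ t : TreeOf α, (t.1.weight : ℚ)⁻¹ • W t.1 = (α.cardAut : ℚ)⁻¹ • ∑ x, V x := by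
  classical
  have := finite_treeLabel hP α.rep
  have := Fintype.ofFinite (TreeLabel α.rep)
  have (x : α.Interval) := Fintype.ofFinite (FactorLabel x)
  -- Grouped by tree: each tree occurs once for every isomorphism of its composite with `α.rep`,
  -- that is, `α.cardAut` times.
  have h1 : ∑ s : TreeLabel α.rep, (s.1.weight : ℚ)⁻¹ • W s.1 =
      (α.cardAut : ℚ) • ∑ t : TreeOf α, (t.1.weight : ℚ)⁻¹ • W t.1 := by
    have (t : TreeOf α) := Fintype.ofFinite (Isos t.1.comp α.rep)
    rw [← (treeLabelRepEquiv α).symm.sum_comp, Fintype.sum_sigma, Finset.smul_sum]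
    refine Finset.sum_congr rfl fun t _ => ?_
    change ∑ _ : Isos t.1.comp α.rep, (t.1.weight : ℚ)⁻¹ • W t.1 = _
    rw [Finset.sum_const, Finset.card_univ, ← Nat.card_eq_fintype_card,
      card_isos (t.2.trans (cls_rep α).symm), cls_rep, Nat.cast_smul_eq_nsmul]
  -- Grouped by element of the interval: the number of labels over `x` equals the weight of every
  -- tree that occurs there, so the inverse weights cancel.
  have h2 : ∑ s : TreeLabel α.rep, (s.1.weight : ℚ)⁻¹ • W s.1 = ∑ x, V x := by
    rw [← (treeLabelEquiv hP α.rep).sum_comp, Fintype.sum_sigma]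
    refine Finset.sum_congr rfl fun x _ => ?_
    have := Fintype.ofFinite (Quotient x.1.part)
    have hw : ∀ D : FactorLabel x, (treeLabel ⟨x, D⟩).1.weight = Nat.card (FactorLabel x) := by
      intro D
      rw [card_factorLabel, ← D.1.cls_eq, Tree.weight,
        ← Equiv.prod_comp D.1.1.2 fun q => (cls (x.1.el q)).cardAut]
      simp only [← (D.2 _).cls_eq]
      rfl
    change ∑ D : FactorLabel x, ((treeLabel ⟨x, D⟩).1.weight : ℚ)⁻¹ • W (treeLabel ⟨x, D⟩).1 = _
    simp only [hw, h]
    rw [Finset.sum_const, Finset.card_univ, ← Nat.card_eq_fintype_card,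
      ← Nat.cast_smul_eq_nsmul ℚ, smul_smul, mul_inv_cancel₀, one_smul]
    rw [Nat.cast_ne_zero, card_factorLabel]
    exact mul_ne_zero (cardAut_ne_zero _) (Finset.prod_ne_zero_iff.2 fun _ _ => cardAut_ne_zero _)
  rw [← h2, h1, smul_smul, inv_mul_cancel₀ (Nat.cast_ne_zero.2 (cardAut_ne_zero α)), one_smul]

end SetOperad

/-! ### The group of formal series -/

namespace SetOperad

variable {P : SetOperad.{u}}

theorem cls_map_unit_comp {K : Type} [Finite K] {J : K → Type} [∀ k, Finite (J k)]
    (e : Unit ≃ K) (y : ∀ k, P.obj (J k)) :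
    cls (P.comp (P.map e P.unit) y) = cls (y (e ())) := by
  have : Subsingleton K := e.symm.injective.subsingleton
  let f : J (e ()) ≃ Σ k, J k := Equiv.ofBijective (Sigma.mk (e ())) ⟨sigma_mk_injective, by
    rintro ⟨k, j⟩
    obtain rfl : e () = k := Subsingleton.elim _ _
    exact ⟨j, rfl⟩⟩
  rw [← cls_map f.symm, map_unit_comp e y f.symm (Equiv.refl _) fun j => f.symm_apply_apply j,
    P.map_refl]

theorem cls_comp_one (t : P.Tree) (h : t.1 = P.one) (i : Fin t.1.arity) : cls t.comp = t.2 i := by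
  obtain ⟨a, b⟩ := t
  obtain rfl : a = P.one := h
  obtain ⟨e, he⟩ := cls_eq_cls_iff.1 (cls_rep P.one).symm
  have : Subsingleton (Fin (P.one).arity) := by rw [arity_one]; infer_instance
  obtain rfl : e () = i := Subsingleton.elim _ _
  refine Eq.trans ?_ ((cls_map_unit_comp e fun i => (b i).rep).trans (cls_rep _))
  rw [he]

theorem cls_comp_unit (a : P.Coinv) : cls (Tree.comp ⟨a, fun _ => P.one⟩) = a := by
  refine (cls_comp_map a.rep _ (fun _ => P.unit) (fun _ => cls_rep _)).trans ?_
  rw [← cls_map (Equiv.sigmaPUnit _), P.comp_unit, cls_rep]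

/-- The tree with one vertex at the root. -/
noncomputable def rootTree (α : P.Coinv) : TreeOf α := ⟨⟨α, fun _ => P.one⟩, cls_comp_unit α⟩

/-- The tree with one vertex above a trivial root. -/
noncomputable def leafTree (α : P.Coinv) : TreeOf α :=
  ⟨⟨P.one, fun _ => α⟩, cls_comp_one _ rfl (Fin.cast arity_one.symm 0)⟩

theorem eq_leafTree {α : P.Coinv} (t : TreeOf α) (h : t.1.1 = P.one) : t = leafTree α := by
  obtain ⟨⟨a, b⟩, rfl⟩ := t
  obtain rfl : a = P.one := h
  refine Subtype.ext (congrArg (Sigma.mk P.one) (funext fun i => ?_))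
  exact (cls_comp_one ⟨P.one, b⟩ rfl i).symm

theorem eq_rootTree {α : P.Coinv} (t : TreeOf α) (h : ∀ i, t.1.2 i = P.one) : t = rootTree α := by
  obtain ⟨⟨a, b⟩, rfl⟩ := t
  obtain rfl : b = fun _ => P.one := funext h
  have := cls_comp_unit a
  refine Subtype.ext ?_
  simp only [rootTree]
  congr 1
  · exact this.symm
  · rw [this]

theorem arity_eq_sum {α : P.Coinv} (t : TreeOf α) : α.arity = ∑ i, (t.1.2 i).arity := by
  obtain ⟨t, rfl⟩ := t
  rw [arity_comp]
  simp only [cls_rep]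

/-- The arity of the composite is the sum of the positive arities of the branches. It equals their
number only if all branches are $\varepsilon$. -/
theorem arity_root_lt [P.IsAugmented] {α : P.Coinv} {t : TreeOf α} (h : t ≠ rootTree α) :
    t.1.1.arity < α.arity := by
  rw [arity_eq_sum t]
  by_contra hle
  refine h (eq_rootTree t fun i => eq_one_iff.2 ?_)
  have h1 : ∑ _ : Fin t.1.1.arity, 1 = ∑ i, (t.1.2 i).arity :=
    le_antisymm (Finset.sum_le_sum fun i _ => arity_pos _) (by simpa using hle)
  exact ((Finset.sum_eq_sum_iff_of_le fun i _ => arity_pos _).1 h1 i (Finset.mem_univ i)).symm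

theorem mulCoeff_eq_sum {R : Type v} [CommSemiring R] (g h : P.Coinv → R) (α : P.Coinv)
    [Fintype (TreeOf α)] :
    mulCoeff g h α = ∑ t : TreeOf α, g t.1.1 * ∏ i, h (t.1.2 i) :=
  finsum_eq_sum_of_fintype _

/-- Trees of height two with composite of class `α`. -/
abbrev TallTreeOf (α : P.Coinv) : Type u :=
  {x : Σ s : P.Tree, ∀ i, Fin (s.2 i).arity → P.Coinv //
    cls (P.comp x.1.1.rep fun i => P.comp (x.1.2 i).rep fun k => (x.2 i k).rep) = α}

theorem cls_comp_cls (s : P.Tree) (c : ∀ i, Fin (s.2 i).arity → P.Coinv)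
    (e : Fin (cls s.comp).arity ≃ Σ i, Fin (s.2 i).arity)
    (he : P.map e (cls s.comp).rep = s.comp) :
    cls (Tree.comp ⟨cls s.comp, fun l => c (e l).1 (e l).2⟩) =
      cls (P.comp s.1.rep fun i => P.comp (s.2 i).rep fun k => (c i k).rep) := by
  have h := P.comp_map_left e (cls s.comp).rep fun p => (c p.1 p.2).rep
  rw [he] at h
  rw [← P.assoc s.1.rep (fun i => (s.2 i).rep) fun i k => (c i k).rep, cls_map, h, cls_map]

/-- Cutting off the upper level of a tree of height two. -/
noncomputable def TallTreeOf.lower {α : P.Coinv} (x : TallTreeOf α) :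
    Σ t : TreeOf α, TreeOf t.1.1 :=
  ⟨⟨⟨cls x.1.1.comp, fun l => x.1.2 ((exists_map_rep x.1.1.comp).choose l).1
    ((exists_map_rep x.1.1.comp).choose l).2⟩,
    (cls_comp_cls _ _ _ (exists_map_rep x.1.1.comp).choose_spec).trans x.2⟩, ⟨x.1.1, rfl⟩⟩

/-- The cut indexes the top level through a chosen isomorphism of the lower composite with its
representative; as the lower tree is kept, inverting this isomorphism recovers the top level. -/
theorem TallTreeOf.lower_bijective {α : P.Coinv} :
    Function.Bijective (TallTreeOf.lower (α := α)) := by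
  constructor
  · rintro ⟨⟨s, c⟩, hc⟩ ⟨⟨s', c'⟩, hc'⟩ h
    obtain rfl : s = s' := congrArg (fun z : Σ t : TreeOf α, TreeOf t.1.1 => z.2.1) h
    let e := (exists_map_rep s.comp).choose
    have h1 : (⟨cls s.comp, fun l => c (e l).1 (e l).2⟩ : P.Tree) =
        ⟨cls s.comp, fun l => c' (e l).1 (e l).2⟩ :=
      congrArg (fun z : Σ t : TreeOf α, TreeOf t.1.1 => z.1.1) h
    refine Subtype.ext (congrArg (Sigma.mk s) (funext fun i => funext fun k => ?_))
    obtain ⟨l, hl⟩ := e.surjective ⟨i, k⟩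
    have h2 : c (e l).1 (e l).2 = c' (e l).1 (e l).2 := congrFun (sigma_mk_injective h1) l
    rw [hl] at h2
    exact h2
  · rintro ⟨⟨⟨a', c'⟩, h⟩, ⟨s, h'⟩⟩
    obtain rfl : cls s.comp = a' := h'
    let e := (exists_map_rep s.comp).choose
    have he : P.map e _ = _ := (exists_map_rep s.comp).choose_spec
    have hc : (fun l => c' (e.symm ⟨(e l).1, (e l).2⟩)) = c' :=
      funext fun l => congrArg c' (e.symm_apply_apply l)
    refine ⟨⟨⟨s, fun i k => c' (e.symm ⟨i, k⟩)⟩, ?_⟩, ?_⟩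
    · rw [← cls_comp_cls s _ e he, hc, h]
    · exact Sigma.ext (Subtype.ext (congrArg (Sigma.mk _) hc)) HEq.rfl

/-- Cutting off the root of a tree of height two. -/
noncomputable def TallTreeOf.upper {α : P.Coinv} (x : TallTreeOf α) :
    Σ t : TreeOf α, ∀ i, TreeOf (t.1.2 i) :=
  ⟨⟨⟨x.1.1.1, fun i => cls (Tree.comp ⟨x.1.1.2 i, x.1.2 i⟩)⟩,
    (cls_comp_map _ _ _ fun _ => cls_rep _).trans x.2⟩, fun i => ⟨⟨x.1.1.2 i, x.1.2 i⟩, rfl⟩⟩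

/-- The branches are replaced by their classes at the root, but the second component keeps the trees
that define them, so nothing is lost. -/
theorem TallTreeOf.upper_bijective {α : P.Coinv} :
    Function.Bijective (TallTreeOf.upper (α := α)) := by
  constructor
  · rintro ⟨⟨⟨a, b⟩, c⟩, hc⟩ ⟨⟨⟨a', b'⟩, c'⟩, hc'⟩ h
    let f : (Σ t : TreeOf α, ∀ i, TreeOf (t.1.2 i)) →
        Σ a : P.Coinv, Fin a.arity → P.Tree := fun z => ⟨z.1.1.1, fun i => (z.2 i).1⟩
    obtain ⟨rfl, h1⟩ := Sigma.mk.inj (congrArg f h)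
    have h2 := congrFun (eq_of_heq h1)
    obtain rfl : b = b' := funext fun i => congrArg Sigma.fst (h2 i)
    obtain rfl : c = c' := funext fun i => sigma_mk_injective (h2 i)
    rfl
  · rintro ⟨⟨⟨a, d⟩, h⟩, s⟩
    obtain ⟨s, hs, rfl⟩ : ∃ (s' : Fin a.arity → P.Tree) (hs : ∀ i, cls (s' i).comp = d i),
        s = fun i => ⟨s' i, hs i⟩ := ⟨fun i => (s i).1, fun i => (s i).2, rfl⟩
    obtain rfl : d = fun i => cls (s i).comp := funext fun i => (hs i).symm
    exact ⟨⟨⟨⟨a, fun i => (s i).1⟩, fun i => (s i).2⟩,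
      (cls_comp_map _ _ _ fun _ => (cls_rep _).symm).trans h⟩, rfl⟩

theorem eq_rootTree_one [P.IsAugmented] (t : TreeOf P.one) : t = rootTree P.one := by
  by_contra h
  have h1 := arity_root_lt h
  have h2 := arity_pos t.1.1
  rw [arity_one] at h1
  omega

section Finite

variable [hT : ∀ α : P.Coinv, Finite (TreeOf α)] {R : Type v}

instance (α : P.Coinv) : Finite (TallTreeOf α) :=
  .of_injective _ TallTreeOf.lower_bijective.injective

/-- After expansion both sides sum `f` at the root times `g` on the middle level times `h` on the
top level, over trees of height two. -/
theorem mulCoeff_assoc [CommSemiring R] (f g h : P.Coinv → R) (α : P.Coinv) :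
    mulCoeff (mulCoeff f g) h α = mulCoeff f (mulCoeff g h) α := by
  classical
  have (α : P.Coinv) := Fintype.ofFinite (TreeOf α)
  have := Fintype.ofFinite (TallTreeOf α)
  simp only [mulCoeff_eq_sum, Finset.sum_mul, Fintype.prod_sum, Finset.mul_sum]
  rw [← Fintype.sum_sigma', ← Fintype.sum_sigma', ← TallTreeOf.lower_bijective.sum_comp,
    ← TallTreeOf.upper_bijective.sum_comp]
  refine Finset.sum_congr rfl fun x _ => ?_
  simp only [TallTreeOf.lower, TallTreeOf.upper, Finset.prod_mul_distrib, mul_assoc]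
  congr 2
  exact (Equiv.prod_comp (exists_map_rep x.1.1.comp).choose fun p => h (x.1.2 p.1 p.2)).trans
    (Fintype.prod_sigma _)

/-- Naturality in the coefficients: it reduces identities between coproducts to identities between
series. -/
theorem map_mulCoeff {R' : Type*} [CommSemiring R] [CommSemiring R'] {F : Type*} [FunLike F R R']
    [RingHomClass F R R'] (φ : F) (g h : P.Coinv → R) (α : P.Coinv) :
    φ (mulCoeff g h α) = mulCoeff (fun a => φ (g a)) (fun b => φ (h b)) α := by
  have := Fintype.ofFinite (TreeOf α)
  simp only [mulCoeff_eq_sum, map_sum, map_mul, map_prod]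

theorem mulCoeff_indicator_left [CommSemiring R] (h : P.Coinv → R) (α : P.Coinv) :
    mulCoeff (Set.indicator {P.one} 1) h α = h α := by
  have := Fintype.ofFinite (TreeOf α)
  rw [mulCoeff_eq_sum, Fintype.sum_eq_single (leafTree α)]
  · have h1 : ∏ _ : Fin P.one.arity, h α = h α := by
      rw [Finset.prod_const, Finset.card_univ, Fintype.card_fin, arity_one, pow_one]
    refine Eq.trans (congrArg₂ _ (Set.indicator_of_mem rfl _) h1) (one_mul _)
  · intro t ht
    rw [Set.indicator_of_notMem, zero_mul]
    exact fun h => ht (eq_leafTree t h)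

theorem mulCoeff_indicator_right [CommSemiring R] (g : P.Coinv → R) (α : P.Coinv) :
    mulCoeff g (Set.indicator {P.one} 1) α = g α := by
  have := Fintype.ofFinite (TreeOf α)
  rw [mulCoeff_eq_sum, Fintype.sum_eq_single (rootTree α)]
  · simp [rootTree]
  · intro t ht
    obtain ⟨i, hi⟩ : ∃ i, t.1.2 i ≠ P.one := by
      by_contra! h
      exact ht (eq_rootTree t h)
    rw [Finset.prod_eq_zero (Finset.mem_univ i) (Set.indicator_of_notMem
      (show t.1.2 i ∉ ({P.one} : Set P.Coinv) from hi) _), mul_zero]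

variable [P.IsAugmented]

theorem mulCoeff_one [CommSemiring R] (g h : P.Coinv → R) (hg : g P.one = 1) (hh : h P.one = 1) :
    mulCoeff g h P.one = 1 := by
  have := Fintype.ofFinite (TreeOf P.one)
  rw [mulCoeff_eq_sum, Fintype.sum_eq_single (rootTree P.one)
    fun t ht => (ht (eq_rootTree_one t)).elim]
  simp [rootTree, hg, hh]

open scoped Classical in
/-- The coefficients of the left inverse of a series. -/
noncomputable def invCoeff [CommRing R] (h : P.Coinv → R) (α : P.Coinv) : R :=
  if α = P.one then 1 else
    -- The condition serves termination and omits exactly the tree `rootTree α`, whose term is the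
    -- unknown coefficient itself.
    -∑ᶠ t : TreeOf α, if _ : t.1.1.arity < α.arity then invCoeff h t.1.1 * ∏ i, h (t.1.2 i) else 0
termination_by α.arity

theorem mulCoeff_invCoeff [CommRing R] (h : P.Coinv → R) (hh : h P.one = 1) (α : P.Coinv) :
    mulCoeff (invCoeff h) h α = Set.indicator {P.one} 1 α := by
  classical
  have := Fintype.ofFinite (TreeOf α)
  by_cases hα : α = P.one
  · subst hα
    rw [mulCoeff_one _ _ _ hh]
    · simp
    · rw [invCoeff, if_pos rfl]
  rw [Set.indicator_of_notMem (by simpa using hα)]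
  have h1 : invCoeff h α = -∑ t : TreeOf α,
      if t.1.1.arity < α.arity then invCoeff h t.1.1 * ∏ i, h (t.1.2 i) else 0 := by
    rw [invCoeff, if_neg hα, finsum_eq_sum_of_fintype]
    simp only [dite_eq_ite]
  have h2 : ∀ t : TreeOf α, invCoeff h t.1.1 * ∏ i, h (t.1.2 i) =
      (if t.1.1.arity < α.arity then invCoeff h t.1.1 * ∏ i, h (t.1.2 i) else 0) +
      if t = rootTree α then invCoeff h α else 0 := by
    intro t
    by_cases ht : t = rootTree α
    · subst ht
      simp [rootTree, hh]
    · rw [if_pos (arity_root_lt ht), if_neg ht, add_zero]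
  rw [mulCoeff_eq_sum, Finset.sum_congr rfl fun t _ => h2 t, Finset.sum_add_distrib,
    Finset.sum_ite_eq', if_pos (Finset.mem_univ _)]
  rw [h1]
  exact add_neg_cancel _

variable (P R) in
/-- The group of formal series. -/
noncomputable abbrev groupPts [CommRing R] : Group (P.GroupPts R) :=
  letI : Mul (P.GroupPts R) := ⟨fun g h => ⟨mulCoeff g.1 h.1, mulCoeff_one _ _ g.2 h.2⟩⟩
  letI : One (P.GroupPts R) := ⟨⟨Set.indicator {P.one} 1, by simp⟩⟩
  letI : Inv (P.GroupPts R) := ⟨fun h => ⟨invCoeff h.1, by rw [invCoeff, if_pos rfl]⟩⟩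
  Group.ofLeftAxioms (fun _ _ _ => Subtype.ext (funext fun _ => mulCoeff_assoc _ _ _ _))
    (fun _ => Subtype.ext (funext fun _ => mulCoeff_indicator_left _ _))
    (fun h => Subtype.ext (funext fun _ => mulCoeff_invCoeff _ h.2 _))

end Finite

end SetOperad

/-! ### The coordinate Hopf algebra -/

namespace SetOperad

variable (P : SetOperad.{u})

/-- The `ℚ`-algebra structure of `MvPolynomial` on the coordinate algebra. -/
noncomputable abbrev coordAlgebra : Algebra ℚ P.CoordAlg :=
  inferInstanceAs (Algebra ℚ (MvPolynomial {α : P.Coinv // α ≠ P.one} ℚ))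

variable {P}

theorem G_one : G P.one = 1 := dif_pos rfl

theorem G_of_ne {α : P.Coinv} (h : α ≠ P.one) :
    G α = (MvPolynomial.X ⟨α, h⟩ : MvPolynomial {α : P.Coinv // α ≠ P.one} ℚ) := dif_neg h

section Algebra

attribute [local instance] coordAlgebra

/-- The algebra morphism with given values on the coordinate functions. -/
noncomputable def coordLift {B : Type v} [CommRing B] [Algebra ℚ B] (g : P.GroupPts B) :
    P.CoordAlg →ₐ[ℚ] B :=
  (MvPolynomial.aeval fun α : {α : P.Coinv // α ≠ P.one} => g.1 α.1 :
    MvPolynomial {α : P.Coinv // α ≠ P.one} ℚ →ₐ[ℚ] B)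

theorem coordLift_G {B : Type v} [CommRing B] [Algebra ℚ B] (g : P.GroupPts B) (α : P.Coinv) :
    coordLift g (G α) = g.1 α := by
  by_cases h : α = P.one
  · rw [h, G_one, map_one, g.2]
  · rw [G_of_ne h]
    exact MvPolynomial.aeval_X _ (⟨α, h⟩ : {α : P.Coinv // α ≠ P.one})

theorem coordAlg_hom_ext {B : Type v} [Semiring B] [Algebra ℚ B] {φ ψ : P.CoordAlg →ₐ[ℚ] B}
    (h : ∀ α, φ (G α) = ψ (G α)) : φ = ψ := by
  refine MvPolynomial.algHom_ext (σ := {α : P.Coinv // α ≠ P.one}) fun α => ?_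
  have := h α.1
  rwa [G_of_ne α.2] at this

variable (P) in
/-- The counit of the coordinate algebra. -/
noncomputable def coordCounit : P.CoordAlg →ₐ[ℚ] ℚ :=
  coordLift ⟨Set.indicator {P.one} 1, by simp⟩

theorem coordCounit_G (α : P.Coinv) : coordCounit P (G α) = Set.indicator {P.one} 1 α :=
  coordLift_G _ _

theorem map_indicator {B : Type v} {C : Type*} [Semiring B] [Semiring C] (φ : B →+* C)
    (α : P.Coinv) : φ (Set.indicator {P.one} 1 α) = Set.indicator {P.one} 1 α := by
  by_cases h : α = P.one <;> simp [h]

variable [hT : ∀ α : P.Coinv, Finite (TreeOf α)] [P.IsAugmented]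

/-- The comultiplication of the coordinate algebra. -/
noncomputable def coordComul : P.CoordAlg →ₐ[ℚ] P.CoordAlg ⊗[ℚ] P.CoordAlg :=
  coordLift ⟨mulCoeff (fun a => 1 ⊗ₜ[ℚ] G a) (fun b => G b ⊗ₜ[ℚ] 1),
    mulCoeff_one _ _ (by rw [G_one]; rfl) (by rw [G_one]; rfl)⟩

theorem coordComul_G (α : P.Coinv) : coordComul (G α) =
    mulCoeff (R := P.CoordAlg ⊗[ℚ] P.CoordAlg) (fun a => 1 ⊗ₜ[ℚ] G a) (fun b => G b ⊗ₜ[ℚ] 1) α :=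
  coordLift_G _ _

theorem map_coordComul_G {B : Type v} [CommRing B] [Algebra ℚ B]
    (φ : P.CoordAlg ⊗[ℚ] P.CoordAlg →ₐ[ℚ] B) (α : P.Coinv) : φ (coordComul (G α)) =
      mulCoeff (fun a => φ (1 ⊗ₜ[ℚ] G a)) (fun b => φ (G b ⊗ₜ[ℚ] 1)) α := by
  rw [coordComul_G, map_mulCoeff]

theorem coordComul_coassoc : (Algebra.TensorProduct.assoc ℚ ℚ ℚ P.CoordAlg P.CoordAlg
      P.CoordAlg).toAlgHom.comp
      ((Algebra.TensorProduct.map coordComul (.id ℚ P.CoordAlg)).comp coordComul) =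
    (Algebra.TensorProduct.map (.id ℚ P.CoordAlg) coordComul).comp coordComul := by
  refine coordAlg_hom_ext fun α => ?_
  let φ : P.CoordAlg ⊗[ℚ] P.CoordAlg →ₐ[ℚ] P.CoordAlg ⊗[ℚ] (P.CoordAlg ⊗[ℚ] P.CoordAlg) :=
    (Algebra.TensorProduct.assoc ℚ ℚ ℚ P.CoordAlg P.CoordAlg P.CoordAlg).toAlgHom.comp
      (Algebra.TensorProduct.map coordComul (.id ℚ P.CoordAlg))
  -- Both composites are triple products of the universal series in the three tensor factors, the
  -- outermost series in the last factor; they differ only in bracketing.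
  have h1 : ∀ a, φ (1 ⊗ₜ[ℚ] G a) = 1 ⊗ₜ[ℚ] (1 ⊗ₜ[ℚ] G a) := fun a => by
    simp [φ, Algebra.TensorProduct.one_def]
  have h2 : ∀ b, φ (G b ⊗ₜ[ℚ] 1) =
      mulCoeff (R := P.CoordAlg ⊗[ℚ] (P.CoordAlg ⊗[ℚ] P.CoordAlg))
        (fun a => 1 ⊗ₜ[ℚ] (G a ⊗ₜ[ℚ] 1)) (fun b => G b ⊗ₜ[ℚ] 1) b := fun b => by
    have : φ (G b ⊗ₜ[ℚ] 1) = (Algebra.TensorProduct.assoc ℚ ℚ ℚ P.CoordAlg P.CoordAlg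
        P.CoordAlg).toAlgHom.comp Algebra.TensorProduct.includeLeft (coordComul (G b)) := by
      simp [φ]
    rw [this, map_coordComul_G]
    rfl
  have h3 : ∀ a, Algebra.TensorProduct.map (.id ℚ P.CoordAlg) coordComul (1 ⊗ₜ[ℚ] G a) =
      mulCoeff (fun a => 1 ⊗ₜ[ℚ] (1 ⊗ₜ[ℚ] G a)) (fun b => 1 ⊗ₜ[ℚ] (G b ⊗ₜ[ℚ] 1)) a := fun a =>
    map_coordComul_G (Algebra.TensorProduct.includeRight : P.CoordAlg ⊗[ℚ] P.CoordAlg →ₐ[ℚ]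
      P.CoordAlg ⊗[ℚ] (P.CoordAlg ⊗[ℚ] P.CoordAlg)) a
  have h4 : ∀ b, Algebra.TensorProduct.map (.id ℚ P.CoordAlg) coordComul (G b ⊗ₜ[ℚ] 1) =
      G b ⊗ₜ[ℚ] (1 : P.CoordAlg ⊗[ℚ] P.CoordAlg) := fun b => by simp
  change φ (coordComul (G α)) =
    Algebra.TensorProduct.map (.id ℚ P.CoordAlg) coordComul (coordComul (G α))
  clear_value φ
  rw [map_coordComul_G φ, map_coordComul_G]
  simp only [h1, h2, h3, h4]
  exact (mulCoeff_assoc _ _ _ _).symm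

variable (P) in
/-- The bialgebra of functions on the group of formal series. -/
noncomputable abbrev coordBialgebra : Bialgebra ℚ P.CoordAlg :=
  Bialgebra.ofAlgHom coordComul (coordCounit P) coordComul_coassoc
    (by
      refine coordAlg_hom_ext fun α => ?_
      rw [AlgHom.comp_apply, map_coordComul_G]
      have h : ∀ b : P.Coinv, Algebra.TensorProduct.map (coordCounit P) (.id ℚ P.CoordAlg)
          (G b ⊗ₜ 1) = Set.indicator {P.one} 1 b := fun b => by
        rw [← map_indicator (Algebra.TensorProduct.includeLeft :
          ℚ →ₐ[ℚ] ℚ ⊗[ℚ] P.CoordAlg).toRingHom, ← coordCounit_G]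
        simp
      simp only [h, mulCoeff_indicator_right]
      simp)
    (by
      refine coordAlg_hom_ext fun α => ?_
      rw [AlgHom.comp_apply, map_coordComul_G]
      have h : ∀ b : P.Coinv, Algebra.TensorProduct.map (.id ℚ P.CoordAlg) (coordCounit P)
          (1 ⊗ₜ G b) = Set.indicator {P.one} 1 b := fun b => by
        rw [← map_indicator (Algebra.TensorProduct.includeRight :
          ℚ →ₐ[ℚ] P.CoordAlg ⊗[ℚ] ℚ).toRingHom, ← coordCounit_G]
        simp
      simp only [h, mulCoeff_indicator_left]
      simp)

attribute [local instance] groupPts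

variable (P) in
/-- The universal point of the group of formal series. -/
noncomputable def univPt : P.GroupPts P.CoordAlg := ⟨G, G_one⟩

theorem mulCoeff_mul_apply {R : Type v} [CommRing R] (g h : P.GroupPts R) (α : P.Coinv) :
    (g * h).1 α = mulCoeff g.1 h.1 α := rfl

theorem one_apply {R : Type v} [CommRing R] (α : P.Coinv) :
    (1 : P.GroupPts R).1 α = Set.indicator {P.one} 1 α := rfl

variable (P) in
/-- The Hopf algebra of functions on the group of formal series. -/
noncomputable abbrev coordHopf : HopfAlgebra ℚ P.CoordAlg :=
  letI := coordBialgebra P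
  have hS : ∀ α, coordLift (univPt P)⁻¹ (G α) = (univPt P)⁻¹.1 α := coordLift_G _
  have h1 : ∀ α, algebraMap ℚ P.CoordAlg (coordCounit P (G α)) =
      (1 : P.GroupPts P.CoordAlg).1 α := fun α => by
    rw [coordCounit_G, map_indicator, one_apply]
  -- The antipode classifies the inverse of the universal series. The left tensor factor carries the
  -- inner series, so the two antipode laws read `univPt P * (univPt P)⁻¹ = 1` and `(univPt P)⁻¹ *
  -- univPt P = 1`, in this order.
  HopfAlgebra.ofAlgHom (coordLift (univPt P)⁻¹)
    (by
      refine coordAlg_hom_ext fun α => ?_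
      change Algebra.TensorProduct.lift _ _ (fun _ _ => Commute.all _ _) (coordComul (G α)) =
        algebraMap ℚ P.CoordAlg (coordCounit P (G α))
      rw [map_coordComul_G, h1, ← mul_inv_cancel (univPt P), mulCoeff_mul_apply]
      simp only [Algebra.TensorProduct.lift_tmul, map_one, one_mul, mul_one, hS]
      rfl)
    (by
      refine coordAlg_hom_ext fun α => ?_
      change Algebra.TensorProduct.lift _ _ (fun _ _ => Commute.all _ _) (coordComul (G α)) =
        algebraMap ℚ P.CoordAlg (coordCounit P (G α))
      rw [map_coordComul_G, h1, ← inv_mul_cancel (univPt P), mulCoeff_mul_apply]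
      simp only [Algebra.TensorProduct.lift_tmul, map_one, one_mul, mul_one, hS]
      rfl)

end Algebra

variable [hT : ∀ α : P.Coinv, Finite (TreeOf α)] [P.IsAugmented]

theorem isCoordHopf : @IsCoordHopf P (coordHopf P) :=
  ⟨fun α => coordComul_G α, fun α => coordCounit_G α⟩

end SetOperad

/-! ### The incidence bialgebra of a hereditary family -/

namespace PosetClass

theorem mk_Iic_Iic {Q : Type u} [PartialOrder Q] {x : Q} (y : Set.Iic x) :
    mk (Set.Iic y) = mk (Set.Iic y.1) :=
  mk_eq_mk
    { toFun := fun z => ⟨z.1.1, z.2⟩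
      invFun := fun z => ⟨⟨z.1, z.2.trans y.2⟩, z.2⟩
      left_inv := fun _ => rfl
      right_inv := fun _ => rfl
      map_rel_iff' := Iff.rfl }

theorem mk_Ici_Ici {Q : Type u} [PartialOrder Q] {y : Q} (x : Set.Ici y) :
    mk (Set.Ici x) = mk (Set.Ici x.1) :=
  mk_eq_mk
    { toFun := fun z => ⟨z.1.1, z.2⟩
      invFun := fun z => ⟨⟨z.1, x.2.trans z.2⟩, z.2⟩
      left_inv := fun _ => rfl
      right_inv := fun _ => rfl
      map_rel_iff' := Iff.rfl }

/-- Both are the interval $[y,x]$, the middle factor in coassociativity. -/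
theorem mk_Ici_Iic {Q : Type u} [PartialOrder Q] {x y : Q} (h : y ≤ x) :
    mk (Set.Ici (⟨y, h⟩ : Set.Iic x)) = mk (Set.Iic (⟨x, h⟩ : Set.Ici y)) :=
  mk_eq_mk
    { toFun := fun z => ⟨⟨z.1.1, z.2⟩, z.1.2⟩
      invFun := fun z => ⟨⟨z.1.1, z.2⟩, z.1.2⟩
      left_inv := fun _ => rfl
      right_inv := fun _ => rfl
      map_rel_iff' := Iff.rfl }

theorem mk_eq_one_iff {Q : Type u} [PartialOrder Q] : mk Q = 1 ↔ Nat.card Q = 1 := by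
  rw [show (1 : PosetClass.{u}) = mk PUnit from rfl, mk_eq_mk_iff, Nat.card_eq_one_iff_unique]
  constructor
  · rintro ⟨e⟩
    exact ⟨e.injective.subsingleton, ⟨e.symm ⟨⟩⟩⟩
  · rintro ⟨h, ⟨x⟩⟩
    exact ⟨{ toFun := fun _ => ⟨⟩
             invFun := fun _ => x
             left_inv := fun _ => Subsingleton.elim _ _
             right_inv := fun _ => rfl
             map_rel_iff' := iff_of_true le_rfl (Subsingleton.elim _ _).le }⟩

/-- Cardinalities multiply; this is what makes the counit multiplicative. -/
theorem mul_eq_one_iff {a b : PosetClass.{u}} : a * b = 1 ↔ a = 1 ∧ b = 1 := by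
  induction a using ind_mk with | h A =>
  induction b using ind_mk with | h B =>
  rw [mk_mul_mk, mk_eq_one_iff, mk_eq_one_iff, mk_eq_one_iff, Nat.card_prod, mul_eq_one]

end PosetClass

namespace IncidenceAlg

variable {S : Submonoid PosetClass.{u}}

variable (S) in
/-- The `ℚ`-algebra structure of the monoid algebra on an incidence algebra. -/
noncomputable abbrev algebraRat : Algebra ℚ (IncidenceAlg S) :=
  inferInstanceAs (Algebra ℚ (MonoidAlgebra ℚ S))

theorem F_mul (c d : S) : F (c * d) = F c * F d :=
  ((MonoidAlgebra.single_mul_single (R := ℚ) c d 1 1).trans (by rw [mul_one]; rfl)).symm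

variable (S) in
theorem F_one : F (1 : S) = 1 := rfl

theorem F_congr {c d : PosetClass.{u}} (h : c = d) (hc : c ∈ S) (hd : d ∈ S) :
    F (⟨c, hc⟩ : S) = F ⟨d, hd⟩ := by
  subst h; rfl

attribute [local instance] algebraRat

variable (S) in
/-- The basis elements of an incidence algebra, as a morphism of monoids. -/
noncomputable def FHom : S →* IncidenceAlg S where
  toFun := F
  map_one' := F_one S
  map_mul' := F_mul

/-- The algebra morphism with given values on the basis. -/
noncomputable def lift {B : Type v} [CommRing B] [Algebra ℚ B] (f : S →* B) :
    IncidenceAlg S →ₐ[ℚ] B :=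
  (MonoidAlgebra.lift ℚ B S f : MonoidAlgebra ℚ S →ₐ[ℚ] B)

theorem lift_F {B : Type v} [CommRing B] [Algebra ℚ B] (f : S →* B) (c : S) :
    lift f (F c) = f c := by
  refine (MonoidAlgebra.lift_single f c (1 : ℚ)).trans ?_
  rw [one_smul]

theorem lin_ext {B : Type v} [AddCommMonoid B] [Module ℚ B] {f g : IncidenceAlg S →ₗ[ℚ] B}
    (h : ∀ c, f (F c) = g (F c)) : f = g :=
  MonoidAlgebra.lhom_ext' (R := ℚ) (S := ℚ) (M := S) fun c => LinearMap.ext_ring (h c)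

theorem hom_ext {B : Type v} [Semiring B] [Algebra ℚ B] {f g : IncidenceAlg S →ₐ[ℚ] B}
    (h : ∀ c, f (F c) = g (F c)) : f = g :=
  AlgHom.toLinearMap_injective (lin_ext h)

variable (hS : IsHereditary S)

/-- The class of an initial interval. -/
abbrev lower {Q : Type u} [PartialOrder Q] (hQ : PosetClass.mk Q ∈ S) (x : Q) : S :=
  ⟨PosetClass.mk (Set.Iic x), hS.Iic_mem Q hQ x⟩

/-- The class of a final interval. -/
abbrev upper {Q : Type u} [PartialOrder Q] (hQ : PosetClass.mk Q ∈ S) (x : Q) : S :=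
  ⟨PosetClass.mk (Set.Ici x), hS.Ici_mem Q hQ x⟩

/-- A poset in a given class. -/
noncomputable abbrev _root_.PosetClass.out (c : PosetClass.{u}) : PartOrd.{u} :=
  Quotient.out (s := posetSetoid) c

theorem _root_.PosetClass.mk_out (c : PosetClass.{u}) : PosetClass.mk c.out = c := Quotient.out_eq c

/-- The comultiplication on the basis. -/
noncomputable def comulF (c : S) : IncidenceAlg S ⊗[ℚ] IncidenceAlg S :=
  ∑ᶠ x : c.1.out,
    F (lower hS (c.1.mk_out.symm ▸ c.2) x) ⊗ₜ[ℚ] F (upper hS (c.1.mk_out.symm ▸ c.2) x)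

/-- The sum is invariant under isomorphism, so the chosen representative may be replaced by any
poset of the class. -/
theorem comulF_mk {Q : Type u} [PartialOrder Q] (hQ : PosetClass.mk Q ∈ S) :
    comulF hS ⟨PosetClass.mk Q, hQ⟩ =
      ∑ᶠ x : Q, F (lower hS hQ x) ⊗ₜ[ℚ] F (upper hS hQ x) := by
  obtain ⟨e⟩ := PosetClass.mk_eq_mk_iff.1 (PosetClass.mk Q).mk_out
  refine finsum_eq_of_bijective e e.bijective fun x => ?_
  rw [F_congr (PosetClass.mk_eq_mk (PosetClass.IicIso e x)) _ (hS.Iic_mem Q hQ (e x)),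
    F_congr (PosetClass.mk_eq_mk (PosetClass.IciIso e x)) _ (hS.Ici_mem Q hQ (e x))]

theorem comulF_one : comulF hS 1 = 1 := by
  refine (comulF_mk hS (Q := PUnit) S.one_mem).trans ?_
  rw [finsum_eq_sum_of_fintype, Fintype.sum_unique,
    F_congr (PosetClass.mk_Iic_one _) _ S.one_mem, F_congr (PosetClass.mk_Ici_one _) _ S.one_mem]
  rfl

theorem comulF_mul (c d : S) : comulF hS (c * d) = comulF hS c * comulF hS d := by
  obtain ⟨c, hc⟩ := c
  obtain ⟨d, hd⟩ := d
  induction c using PosetClass.ind_mk with | h A =>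
  induction d using PosetClass.ind_mk with | h B =>
  have := hS.finite A hc
  have := hS.finite B hd
  have := Fintype.ofFinite A
  have := Fintype.ofFinite B
  refine (comulF_mk hS (Q := A × B) (S.mul_mem hc hd)).trans ?_
  rw [comulF_mk, comulF_mk, finsum_eq_sum_of_fintype, finsum_eq_sum_of_fintype,
    finsum_eq_sum_of_fintype, Finset.sum_mul_sum, Fintype.sum_prod_type]
  refine Finset.sum_congr rfl fun x _ => Finset.sum_congr rfl fun y _ => ?_
  rw [Algebra.TensorProduct.tmul_mul_tmul, ← F_mul, ← F_mul]
  exact congrArg₂ _ (F_congr (PosetClass.mk_Iic_prod (x, y)) _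
    (S.mul_mem (hS.Iic_mem A hc x) (hS.Iic_mem B hd y)))
    (F_congr (PosetClass.mk_Ici_prod (x, y)) _
    (S.mul_mem (hS.Ici_mem A hc x) (hS.Ici_mem B hd y)))

/-- The comultiplication of the incidence Hopf algebra. -/
noncomputable def comul : IncidenceAlg S →ₐ[ℚ] IncidenceAlg S ⊗[ℚ] IncidenceAlg S :=
  lift { toFun := comulF hS, map_one' := comulF_one hS, map_mul' := comulF_mul hS }

theorem comul_F {Q : Type u} [PartialOrder Q] (hQ : PosetClass.mk Q ∈ S) :
    comul hS (F ⟨PosetClass.mk Q, hQ⟩) =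
      ∑ᶠ x : Q, F (lower hS hQ x) ⊗ₜ[ℚ] F (upper hS hQ x) :=
  (lift_F _ _).trans (comulF_mk hS hQ)

theorem map_comul_F {B : Type v} [AddCommMonoid B] [Module ℚ B]
    (f : IncidenceAlg S ⊗[ℚ] IncidenceAlg S →ₗ[ℚ] B) {Q : Type u} [PartialOrder Q] [Fintype Q]
    (hQ : PosetClass.mk Q ∈ S) :
    f (comul hS (F ⟨PosetClass.mk Q, hQ⟩)) =
      ∑ x : Q, f (F (lower hS hQ x) ⊗ₜ[ℚ] F (upper hS hQ x)) := by
  rw [comul_F, finsum_eq_sum_of_fintype, map_sum]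

variable (S) in
/-- The counit of the incidence Hopf algebra. -/
noncomputable def counit : IncidenceAlg S →ₐ[ℚ] ℚ :=
  lift
    { toFun := Set.indicator {1} 1
      map_one' := by simp
      map_mul' := fun c d => by
        have h : c * d = 1 ↔ c = 1 ∧ d = 1 := by
          simp only [← SetLike.coe_eq_coe, Submonoid.coe_mul, Submonoid.coe_one]
          exact PosetClass.mul_eq_one_iff
        by_cases hc : c = 1 <;> by_cases hd : d = 1 <;> simp [Set.indicator, h, hc, hd] }

theorem counit_F (c : S) : counit S (F c) = Set.indicator {1} 1 c := lift_F _ _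

theorem counit_F_mk {Q : Type u} [PartialOrder Q] (hQ : PosetClass.mk Q ∈ S)
    (h : Nat.card Q ≠ 1) : counit S (F ⟨PosetClass.mk Q, hQ⟩) = 0 := by
  rw [counit_F]
  refine Set.indicator_of_notMem (fun h' => h ?_) _
  exact PosetClass.mk_eq_one_iff.1 (congrArg Subtype.val h')

theorem F_eq_one {Q : Type u} [PartialOrder Q] (hQ : PosetClass.mk Q ∈ S)
    (h : Nat.card Q = 1) : F ⟨PosetClass.mk Q, hQ⟩ = 1 :=
  F_congr (PosetClass.mk_eq_one_iff.2 h) _ S.one_mem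

theorem comul_coassoc : (Algebra.TensorProduct.assoc ℚ ℚ ℚ (IncidenceAlg S) (IncidenceAlg S)
      (IncidenceAlg S)).toAlgHom.comp
      ((Algebra.TensorProduct.map (comul hS) (.id ℚ (IncidenceAlg S))).comp (comul hS)) =
    (Algebra.TensorProduct.map (.id ℚ (IncidenceAlg S)) (comul hS)).comp (comul hS) := by
  refine hom_ext fun ⟨c, hc⟩ => ?_
  induction c using PosetClass.ind_mk with | h Q =>
  have := hS.finite Q hc
  have := Fintype.ofFinite Q
  have (x : Q) := Fintype.ofFinite (Set.Iic x)
  have (x : Q) := Fintype.ofFinite (Set.Ici x)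
  have h1 : ∀ x : Q, Algebra.TensorProduct.assoc ℚ ℚ ℚ (IncidenceAlg S) (IncidenceAlg S)
      (IncidenceAlg S) (Algebra.TensorProduct.map (comul hS) (.id ℚ (IncidenceAlg S))
        (F (lower hS hc x) ⊗ₜ[ℚ] F (upper hS hc x))) =
      ∑ y : Set.Iic x, F (lower hS hc y.1) ⊗ₜ[ℚ]
        (F (upper hS (hS.Iic_mem Q hc x) y) ⊗ₜ[ℚ] F (upper hS hc x)) := fun x => by
    rw [Algebra.TensorProduct.map_tmul, comul_F, finsum_eq_sum_of_fintype, TensorProduct.sum_tmul,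
      map_sum]
    refine Finset.sum_congr rfl fun y _ => ?_
    rw [F_congr (PosetClass.mk_Iic_Iic y) _ (hS.Iic_mem Q hc y.1)]
    rfl
  have h2 : ∀ y : Q, Algebra.TensorProduct.map (.id ℚ (IncidenceAlg S)) (comul hS)
        (F (lower hS hc y) ⊗ₜ[ℚ] F (upper hS hc y)) =
      ∑ x : Set.Ici y, F (lower hS hc y) ⊗ₜ[ℚ]
        (F (lower hS (hS.Ici_mem Q hc y) x) ⊗ₜ[ℚ] F (upper hS hc x.1)) := fun y => by
    rw [Algebra.TensorProduct.map_tmul, comul_F, finsum_eq_sum_of_fintype, TensorProduct.tmul_sum]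
    refine Finset.sum_congr rfl fun x _ => ?_
    rw [F_congr (PosetClass.mk_Ici_Ici x) _ (hS.Ici_mem Q hc x.1)]
    rfl
  refine (map_comul_F hS ((Algebra.TensorProduct.assoc ℚ ℚ ℚ (IncidenceAlg S) (IncidenceAlg S)
    (IncidenceAlg S)).toAlgHom.comp
      (Algebra.TensorProduct.map (comul hS) (.id ℚ (IncidenceAlg S)))).toLinearMap hc).trans ?_
  refine Eq.trans ?_ (map_comul_F hS (Algebra.TensorProduct.map (.id ℚ (IncidenceAlg S))
    (comul hS)).toLinearMap hc).symm
  refine (Finset.sum_congr rfl fun x _ => h1 x).trans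
    (Eq.trans ?_ (Finset.sum_congr rfl fun y _ => h2 y).symm)
  rw [← Fintype.sum_sigma', ← Fintype.sum_sigma']
  -- Both iterated coproducts are sums over pairs `y ≤ x`.
  let e : (Σ x : Q, Set.Iic x) ≃ (Σ y : Q, Set.Ici y) :=
    { toFun := fun p => ⟨p.2.1, p.1, p.2.2⟩
      invFun := fun p => ⟨p.2.1, p.1, p.2.2⟩
      left_inv := fun _ => rfl
      right_inv := fun _ => rfl }
  refine Fintype.sum_equiv e _ _ fun ⟨x, y, h⟩ => ?_
  exact congrArg (fun z => F (lower hS hc y) ⊗ₜ[ℚ] (z ⊗ₜ[ℚ] F (upper hS hc x)))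
    (F_congr (PosetClass.mk_Ici_Iic h) _ _)

/-- The bialgebra structure of the incidence Hopf algebra. -/
noncomputable abbrev bialgebra : Bialgebra ℚ (IncidenceAlg S) :=
  Bialgebra.ofAlgHom (comul hS) (counit S) (comul_coassoc hS)
    (by
      refine hom_ext fun ⟨c, hc⟩ => ?_
      induction c using PosetClass.ind_mk with | h Q =>
      have := hS.finite Q hc
      have := Fintype.ofFinite Q
      obtain ⟨b, hb⟩ := hS.exists_isBot Q hc
      refine (map_comul_F hS (Algebra.TensorProduct.map (counit S)
        (.id ℚ (IncidenceAlg S))).toLinearMap hc).trans ?_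
      rw [Fintype.sum_eq_single b fun x hx => ?_]
      · have h1 : Nat.card (Set.Iic b) = 1 := by
          rw [Nat.card_eq_one_iff_unique]
          exact ⟨⟨fun x y => Subtype.ext ((le_antisymm x.2 (hb _)).trans
            (le_antisymm y.2 (hb _)).symm)⟩, ⟨⟨b, le_rfl⟩⟩⟩
        have h2 : PosetClass.mk (Set.Ici b) = PosetClass.mk Q :=
          PosetClass.mk_eq_mk
            { toFun := fun x => x.1
              invFun := fun x => ⟨x, hb x⟩
              left_inv := fun _ => rfl
              right_inv := fun _ => rfl
              map_rel_iff' := Iff.rfl }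
        change counit S _ ⊗ₜ[ℚ] F _ = 1 ⊗ₜ[ℚ] F _
        rw [F_eq_one _ h1, map_one, F_congr h2]
      · have : Nat.card (Set.Iic x) ≠ 1 := fun h => by
          rw [Nat.card_eq_one_iff_unique] at h
          exact hx (congrArg Subtype.val (h.1.elim ⟨x, le_rfl⟩ ⟨b, hb x⟩))
        change counit S _ ⊗ₜ[ℚ] F _ = 0
        rw [counit_F_mk _ this, TensorProduct.zero_tmul])
    (by
      refine hom_ext fun ⟨c, hc⟩ => ?_
      induction c using PosetClass.ind_mk with | h Q =>
      have := hS.finite Q hc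
      have := Fintype.ofFinite Q
      obtain ⟨b, hb⟩ := hS.exists_isTop Q hc
      refine (map_comul_F hS (Algebra.TensorProduct.map (.id ℚ (IncidenceAlg S))
        (counit S)).toLinearMap hc).trans ?_
      rw [Fintype.sum_eq_single b fun x hx => ?_]
      · have h1 : Nat.card (Set.Ici b) = 1 := by
          rw [Nat.card_eq_one_iff_unique]
          exact ⟨⟨fun x y => Subtype.ext ((le_antisymm (hb _) x.2).trans
            (le_antisymm (hb _) y.2).symm)⟩, ⟨⟨b, le_rfl⟩⟩⟩
        have h2 : PosetClass.mk (Set.Iic b) = PosetClass.mk Q :=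
          PosetClass.mk_eq_mk
            { toFun := fun x => x.1
              invFun := fun x => ⟨x, hb x⟩
              left_inv := fun _ => rfl
              right_inv := fun _ => rfl
              map_rel_iff' := Iff.rfl }
        change F _ ⊗ₜ[ℚ] counit S _ = F _ ⊗ₜ[ℚ] 1
        rw [F_eq_one _ h1, map_one, F_congr h2]
      · have : Nat.card (Set.Ici x) ≠ 1 := fun h => by
          rw [Nat.card_eq_one_iff_unique] at h
          exact hx (congrArg Subtype.val (h.1.elim ⟨x, le_rfl⟩ ⟨b, hb x⟩))
        change F _ ⊗ₜ[ℚ] counit S _ = 0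
        rw [counit_F_mk _ this, TensorProduct.tmul_zero])

end IncidenceAlg

/-! ### The antipode of the incidence bialgebra -/

namespace IncidenceAlg

section Antipode

variable {S : Submonoid PosetClass.{u}} [hS : Fact (IsHereditary S)]

attribute [local instance] algebraRat

/-- The bialgebra structure, with heredity found by instance search. -/
noncomputable abbrev bialgebraOfFact : Bialgebra ℚ (IncidenceAlg S) := bialgebra hS.out

attribute [local instance] bialgebraOfFact

open WithConv

theorem convMul_F (f g : WithConv (IncidenceAlg S →ₗ[ℚ] IncidenceAlg S)) {Q : Type u}
    [PartialOrder Q] [Fintype Q] (hQ : PosetClass.mk Q ∈ S) :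
    (f * g) (F ⟨PosetClass.mk Q, hQ⟩) =
      ∑ x : Q, f (F (lower hS.out hQ x)) * g (F (upper hS.out hQ x)) :=
  map_comul_F hS.out (LinearMap.mul' ℚ (IncidenceAlg S) ∘ₗ
    TensorProduct.map f.ofConv g.ofConv) hQ

variable (S) in
/-- The augmentation `ε - id` in the convolution algebra. -/
noncomputable def aug : WithConv (IncidenceAlg S →ₗ[ℚ] IncidenceAlg S) :=
  1 - toConv LinearMap.id

/-- In `aug * aug ^ k` the term at $x=\widehat 0$ vanishes because `aug` kills $1$; at every other
`x` the final interval is strictly smaller than `Q`, so the induction applies. The start is void, as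
`Q` is nonempty. -/
theorem aug_pow_F (k : ℕ) : ∀ {Q : Type u} [PartialOrder Q] (hQ : PosetClass.mk Q ∈ S),
    Nat.card Q ≤ k → (aug S ^ k) (F ⟨PosetClass.mk Q, hQ⟩) = 0 := by
  induction k with
  | zero =>
    intro Q _ hQ h
    have := hS.out.finite Q hQ
    obtain ⟨b, -⟩ := hS.out.exists_isBot Q hQ
    have : Nonempty Q := ⟨b⟩
    exact absurd h Nat.card_pos.not_ge
  | succ k ih =>
    intro Q _ hQ h
    have := hS.out.finite Q hQ
    have := Fintype.ofFinite Q
    rw [pow_succ', convMul_F]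
    refine Finset.sum_eq_zero fun x _ => ?_
    by_cases hx : IsBot x
    · have h1 : Nat.card (Set.Iic x) = 1 := by
        rw [Nat.card_eq_one_iff_unique]
        exact ⟨⟨fun y z => Subtype.ext ((le_antisymm y.2 (hx _)).trans
          (le_antisymm z.2 (hx _)).symm)⟩, ⟨⟨x, le_rfl⟩⟩⟩
      have : aug S (F (lower hS.out hQ x)) = 0 := by
        rw [F_eq_one _ h1]
        change algebraMap ℚ (IncidenceAlg S) (counit S 1) - 1 = 0
        rw [map_one, map_one, sub_self]
      rw [this, zero_mul]
    · have : Nat.card (Set.Ici x) < Nat.card Q :=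
        Set.ncard_lt_card fun h' => hx fun y => h'.ge (Set.mem_univ y)
      rw [ih _ (by lia), mul_zero]

variable (S) in
/-- The partial sums of the geometric series inverse to the identity. -/
noncomputable def geom (n : ℕ) : WithConv (IncidenceAlg S →ₗ[ℚ] IncidenceAlg S) :=
  ∑ k ∈ Finset.range n, aug S ^ k

theorem geom_F {n m : ℕ} {Q : Type u} [PartialOrder Q] (hQ : PosetClass.mk Q ∈ S)
    (hn : Nat.card Q ≤ n) (h : n ≤ m) :
    geom S m (F ⟨PosetClass.mk Q, hQ⟩) = geom S n (F ⟨PosetClass.mk Q, hQ⟩) := by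
  induction m, h using Nat.le_induction with
  | base => rfl
  | succ m hm ih =>
    rw [← ih, geom, Finset.sum_range_succ]
    change geom S m _ + (aug S ^ m) _ = _
    rw [aug_pow_F m hQ (hn.trans hm), add_zero]

theorem geom_mul_id (n : ℕ) : geom S n * toConv LinearMap.id = 1 - aug S ^ n := by
  have h : (toConv LinearMap.id : WithConv (IncidenceAlg S →ₗ[ℚ] IncidenceAlg S)) =
      1 - aug S := by simp [aug]
  rw [h, geom]
  exact geom_sum_mul_neg _ _

theorem id_mul_geom (n : ℕ) : toConv LinearMap.id * geom S n = 1 - aug S ^ n := by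
  have h : (toConv LinearMap.id : WithConv (IncidenceAlg S →ₗ[ℚ] IncidenceAlg S)) =
      1 - aug S := by simp [aug]
  rw [h, geom]
  exact mul_neg_geom_sum _ _

variable (S) in
/-- The antipode of the incidence Hopf algebra. -/
noncomputable def antipodeFun : IncidenceAlg S →ₗ[ℚ] IncidenceAlg S :=
  (Finsupp.linearCombination ℚ fun c : S => geom S (Nat.card c.1.out) (F c)) ∘ₗ
    (MonoidAlgebra.coeffLinearEquiv ℚ : MonoidAlgebra ℚ S ≃ₗ[ℚ] (S →₀ ℚ)).toLinearMap

/-- The partial sums are constant on this basis element from `Nat.card Q` on, so any larger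
truncation computes the antipode. -/
theorem antipodeFun_F {Q : Type u} [PartialOrder Q] (hQ : PosetClass.mk Q ∈ S) {n : ℕ}
    (h : Nat.card Q ≤ n) :
    antipodeFun S (F ⟨PosetClass.mk Q, hQ⟩) = geom S n (F ⟨PosetClass.mk Q, hQ⟩) := by
  obtain ⟨e⟩ := PosetClass.mk_eq_mk_iff.1 (PosetClass.mk Q).mk_out
  rw [geom_F hQ (Nat.card_congr e.toEquiv).ge (m := n)]
  · refine (Finsupp.linearCombination_single _ _ _).trans ?_
    rw [one_smul]
  · exact (Nat.card_congr e.toEquiv).trans_le h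

theorem antipodeFun_mul_id : toConv (antipodeFun S) * toConv LinearMap.id = 1 := by
  refine ofConv_injective (lin_ext fun ⟨c, hc⟩ => ?_)
  induction c using PosetClass.ind_mk with | h Q =>
  have := hS.out.finite Q hc
  have := Fintype.ofFinite Q
  have h : (geom S (Nat.card Q) * toConv LinearMap.id :
      WithConv (IncidenceAlg S →ₗ[ℚ] _)) (F ⟨PosetClass.mk Q, hc⟩) =
      (1 : WithConv (IncidenceAlg S →ₗ[ℚ] IncidenceAlg S)) (F ⟨PosetClass.mk Q, hc⟩) := by
    rw [geom_mul_id]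
    change _ - (aug S ^ _) _ = _
    rw [aug_pow_F _ hc le_rfl, sub_zero]
    rfl
  refine Eq.trans ?_ h
  refine (convMul_F _ _ hc).trans (Eq.trans ?_ (convMul_F _ _ hc).symm)
  -- No initial interval has more elements than `Q`, so one truncation serves all terms.
  refine Finset.sum_congr rfl fun x _ => congrArg (· * _) ?_
  exact antipodeFun_F _ (Nat.card_le_card_of_injective _ Subtype.val_injective)

theorem id_mul_antipodeFun : toConv LinearMap.id * toConv (antipodeFun S) = 1 := by
  refine ofConv_injective (lin_ext fun ⟨c, hc⟩ => ?_)
  induction c using PosetClass.ind_mk with | h Q =>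
  have := hS.out.finite Q hc
  have := Fintype.ofFinite Q
  have h : (toConv LinearMap.id * geom S (Nat.card Q) :
      WithConv (IncidenceAlg S →ₗ[ℚ] _)) (F ⟨PosetClass.mk Q, hc⟩) =
      (1 : WithConv (IncidenceAlg S →ₗ[ℚ] IncidenceAlg S)) (F ⟨PosetClass.mk Q, hc⟩) := by
    rw [id_mul_geom]
    change _ - (aug S ^ _) _ = _
    rw [aug_pow_F _ hc le_rfl, sub_zero]
    rfl
  refine Eq.trans ?_ h
  refine (convMul_F _ _ hc).trans (Eq.trans ?_ (convMul_F _ _ hc).symm)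
  refine Finset.sum_congr rfl fun x _ => congrArg (F (lower hS.out hc x) * ·) ?_
  exact antipodeFun_F _ (Nat.card_le_card_of_injective _ Subtype.val_injective)

variable (S) in
/-- The incidence Hopf algebra, with heredity found by instance search. -/
noncomputable abbrev hopfOfFact : HopfAlgebra ℚ (IncidenceAlg S) :=
  HopfAlgebra.ofConvInverse (antipodeFun S) antipodeFun_mul_id id_mul_antipodeFun

end Antipode

/-- The incidence Hopf algebra of a hereditary family. -/
noncomputable abbrev hopf {S : Submonoid PosetClass.{u}} (hS : IsHereditary S) :
    HopfAlgebra ℚ (IncidenceAlg S) :=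
  haveI : Fact (IsHereditary S) := ⟨hS⟩
  hopfOfFact S

theorem isIncidenceHopf {S : Submonoid PosetClass.{u}} (hS : IsHereditary S) :
    @IsIncidenceHopf S hS (hopf hS) :=
  ⟨fun _ _ hQ => comul_F hS hQ, fun c => counit_F c⟩

end IncidenceAlg

/-! ### The morphism from the coordinate to the incidence Hopf algebra -/

namespace SetOperad

variable {P : SetOperad.{u}}

theorem cardAut_one : P.one.cardAut = 1 := by
  have : Subsingleton (Fin P.one.arity) := by rw [arity_one]; infer_instance
  rw [Coinv.cardAut, Nat.card_eq_one_iff_unique]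
  exact ⟨inferInstance, ⟨⟨Equiv.refl _, P.map_refl _⟩⟩⟩

variable [P.IsAugmented]

instance PiElem.subsingleton {I : Type} [Finite I] [Subsingleton I] :
    Subsingleton (P.PiElem I) where
  allEq := by
    rintro ⟨r, a⟩ ⟨s, b⟩
    obtain rfl : r = s := Setoid.ext fun i j => by
      rw [Subsingleton.elim i j]
      exact iff_of_true (r.refl j) (s.refl j)
    congr 1
    funext q
    induction q using Quotient.inductionOn with | h i =>
    let _ : Unique {j // Quotient.mk r j = Quotient.mk r i} :=
      { default := ⟨i, rfl⟩, uniq := fun _ => Subsingleton.elim _ _ }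
    exact (subsingleton_obj (P := P)).elim _ _

/-- If $\widehat 0=\widehat 1$, the discrete and the coarse partition coincide, which forces arity
one. This matches the two counits. -/
theorem card_interval_eq_one_iff {α : P.Coinv} : Nat.card α.Interval = 1 ↔ α = P.one := by
  rw [Nat.card_eq_one_iff_unique]
  constructor
  · rintro ⟨h, -⟩
    have h1 := congrArg (PiElem.part ∘ Subtype.val)
      (h.elim ⟨_, le_rfl, PiElem.zero_le _⟩ ⟨_, PiElem.zero_le _, le_rfl⟩)
    change (⊥ : Setoid (Fin α.arity)) = ⊤ at h1
    have : Subsingleton (Fin α.arity) := ⟨fun i j => by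
      have h2 : (⊤ : Setoid (Fin α.arity)) i j := trivial
      rwa [← h1] at h2⟩
    rw [eq_one_iff]
    have h3 := Fin.subsingleton_iff_le_one.1 this
    have := arity_pos α
    lia
  · rintro rfl
    have : Subsingleton (Fin P.one.arity) := by rw [arity_one]; infer_instance
    exact ⟨inferInstance, ⟨⟨_, le_rfl, PiElem.zero_le _⟩⟩⟩

theorem interval_mem (α : P.Coinv) : PosetClass.mk α.Interval ∈ P.intervalClasses :=
  Submonoid.subset_closure ⟨α, rfl⟩

theorem F_eq (α : P.Coinv) : F α = IncidenceAlg.F ⟨PosetClass.mk α.Interval, interval_mem α⟩ := rfl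

theorem F_one : F P.one = 1 :=
  IncidenceAlg.F_eq_one _ (card_interval_eq_one_iff.2 rfl)

theorem prod_F {n : ℕ} (b : Fin n → P.Coinv) {c : PosetClass.{u}} (hc : c ∈ P.intervalClasses)
    (h : ∏ i, PosetClass.mk (b i).Interval = c) : ∏ i, F (b i) = IncidenceAlg.F ⟨c, hc⟩ := by
  have := map_prod (IncidenceAlg.FHom P.intervalClasses)
    (fun i => ⟨PosetClass.mk (b i).Interval, interval_mem (b i)⟩) Finset.univ
  refine this.symm.trans (congrArg IncidenceAlg.F (Subtype.ext ?_))
  exact (Submonoid.coe_finsetProd _ _ _).trans h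

variable (P) in
/-- The point `∑ α, F_[α] / #Aut(α) α` of the group of formal series. -/
noncomputable def rhoPt : P.GroupPts P.IncAlg :=
  letI := IncidenceAlg.algebraRat P.intervalClasses
  ⟨fun α => (α.cardAut : ℚ)⁻¹ • F α, by
    beta_reduce
    rw [cardAut_one, F_one, Nat.cast_one, inv_one, one_smul]⟩

section Rho

attribute [local instance] coordAlgebra IncidenceAlg.algebraRat

variable (P) in
/-- The morphism of algebras `ρ`. -/
noncomputable def rhoAlg : P.CoordAlg →ₐ[ℚ] P.IncAlg := coordLift (rhoPt P)

theorem rhoAlg_G (α : P.Coinv) : rhoAlg P (G α) = (α.cardAut : ℚ)⁻¹ • F α := coordLift_G _ _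

theorem rhoAlg_surjective : Function.Surjective (rhoAlg P) := by
  have hF : ∀ c : P.intervalClasses, IncidenceAlg.F c ∈ (rhoAlg P).range := by
    rintro ⟨c, hc⟩
    induction hc using Submonoid.closure_induction with
    | mem c hc =>
      obtain ⟨α, rfl⟩ := hc
      refine ⟨(α.cardAut : ℚ) • G α, ?_⟩
      change rhoAlg P _ = _
      rw [map_smul, rhoAlg_G, smul_smul,
        mul_inv_cancel₀ (Nat.cast_ne_zero.2 (cardAut_ne_zero α)), one_smul]
      rfl
    | one => exact one_mem (rhoAlg P).range
    | mul a b ha hb iha ihb =>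
      have := mul_mem iha ihb
      rwa [← IncidenceAlg.F_mul] at this
  -- The quotient by the range is tested on the basis.
  have h : (LinearMap.range (rhoAlg P).toLinearMap).mkQ = 0 :=
    IncidenceAlg.lin_ext fun c => (Submodule.Quotient.mk_eq_zero _).2 (hF c)
  have h2 := congrArg LinearMap.ker h
  rw [Submodule.ker_mkQ, LinearMap.ker_zero, LinearMap.range_eq_top] at h2
  exact h2

theorem counit_rhoAlg :
    (IncidenceAlg.counit P.intervalClasses).comp (rhoAlg P) = coordCounit P := by
  refine coordAlg_hom_ext fun α => ?_
  rw [AlgHom.comp_apply, rhoAlg_G, map_smul, coordCounit_G]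
  by_cases h : α = P.one
  · subst h
    rw [F_one, map_one, cardAut_one]
    simp
  · rw [F_eq, IncidenceAlg.counit_F_mk _ (mt card_interval_eq_one_iff.1 h), smul_zero]
    simp [h]

variable [hS : Fact (IsHereditary P.intervalClasses)] [hT : ∀ α : P.Coinv, Finite (TreeOf α)]

/-- The factors $1/\#\mathrm{Aut}$ of the vertices of a tree multiply to the inverse of its weight,
so the double count applies. -/
theorem comul_rhoAlg (hP : P.IsBasic) :
    (Algebra.TensorProduct.map (rhoAlg P) (rhoAlg P)).comp coordComul =
      (IncidenceAlg.comul hS.out).comp (rhoAlg P) := by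
  refine coordAlg_hom_ext fun α => ?_
  have := hS.out.finite α.Interval (interval_mem α)
  have := Fintype.ofFinite α.Interval
  have := Fintype.ofFinite (TreeOf α)
  rw [AlgHom.comp_apply, AlgHom.comp_apply, map_coordComul_G, rhoAlg_G, map_smul, F_eq,
    IncidenceAlg.comul_F, finsum_eq_sum_of_fintype, mulCoeff_eq_sum,
    ← sum_tree_eq_sum_interval hP α
      (fun t => (∏ i, F (t.2 i)) ⊗ₜ[ℚ] F t.1) _ fun x D => ?_]
  · refine Finset.sum_congr rfl fun t _ => ?_
    simp only [Algebra.TensorProduct.map_tmul, map_one, rhoAlg_G]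
    have h (b : P.Coinv) : ((b.cardAut : ℚ)⁻¹ • F b) ⊗ₜ[ℚ] (1 : P.IncAlg) =
        (b.cardAut : ℚ)⁻¹ • Algebra.TensorProduct.includeLeft (R := ℚ) (S := ℚ) (F b) := rfl
    simp only [h, Finset.prod_smul, ← map_prod]
    rw [Algebra.TensorProduct.includeLeft_apply, mul_smul_comm, TensorProduct.tmul_smul,
      smul_mul_assoc, Algebra.TensorProduct.tmul_mul_tmul, one_mul, mul_one, smul_smul,
      Tree.weight, Nat.cast_mul, Nat.cast_prod, mul_inv_rev, Finset.prod_inv_distrib]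
  · have := Fintype.ofFinite (Quotient x.1.part)
    -- The tree of a label over `x` has the classes of the parts of `x` as branches and the class of
    -- the outer factor as root; these give the initial and the final interval at `x`.
    refine congrArg₂ _ (prod_F _ _ ?_) (IncidenceAlg.F_congr ?_ _ _)
    · rw [PosetClass.mk_Iic_Icc, mk_Icc_zero,
        ← Equiv.prod_comp D.1.1.2 fun q => ivl (x.1.el q)]
      refine Finset.prod_congr rfl fun i _ => ?_
      rw [ivl_eq hP, ← (D.2 i).cls_eq]
      rfl
    · rw [PosetClass.mk_Ici_Icc, mk_Icc_single hP (comp_outer x), ivl_eq hP, ← D.1.cls_eq]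
      rfl

end Rho

end SetOperad

/-! ### Groups of points and the conclusion -/

/-- The convolution group of algebra morphisms from a Hopf algebra to a commutative algebra. -/
noncomputable abbrev AlgHom.convGroupOfAlgebra {R A B : Type*} [CommRing R] [CommRing A]
    [CommRing B] [HopfAlgebra R A] [Algebra R B] : Group (WithConv (A →ₐ[R] B)) where
  inv φ := .toConv (φ.ofConv.comp (HopfAlgebra.antipodeAlgHom R A))
  inv_mul_cancel φ := by
    refine WithConv.ofConv_injective ((AlgHom.comp_convMul_distrib φ.ofConv
      (.toConv (HopfAlgebra.antipodeAlgHom R A)) (.toConv (AlgHom.id R A))).symm.trans ?_)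
    rw [AlgHom.antipode_id_cancel]
    exact AlgHom.ext fun a => φ.ofConv.commutes _

/-- Both sides, as functions of `a`, are convolution inverses of `f`. -/
theorem BialgHom.map_antipode {R A B : Type*} [CommRing R] [CommRing A] [CommRing B]
    [HopfAlgebra R A] [HopfAlgebra R B] (f : A →ₐc[R] B) (a : A) :
    f (HopfAlgebra.antipode R a) = HopfAlgebra.antipode R (f a) := by
  let g : WithConv (A →ₐ[R] B) := .toConv (f : A →ₐ[R] B)
  have h1 : WithConv.toConv ((HopfAlgebra.antipodeAlgHom R B).comp (f : A →ₐ[R] B)) * g = 1 := by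
    refine WithConv.ofConv_injective ((AlgHom.convMul_comp_bialgHom_distrib
      (.toConv (HopfAlgebra.antipodeAlgHom R B)) (.toConv (AlgHom.id R B)) f).symm.trans ?_)
    rw [AlgHom.antipode_id_cancel]
    refine AlgHom.ext fun a => ?_
    exact congrArg (algebraMap R B) (CoalgHomClass.counit_comp_apply f a)
  have h2 := congrArg WithConv.ofConv (eq_inv_of_mul_eq_one_left h1)
  exact (DFunLike.congr_fun h2 a).symm

namespace SetOperad

variable {P : SetOperad.{u}}

section Points

attribute [local instance] coordAlgebra IncidenceAlg.algebraRat coordHopf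
  IncidenceAlg.hopfOfFact groupPts
  AlgHom.convGroupOfAlgebra

variable [hT : ∀ α : P.Coinv, Finite (TreeOf α)] [P.IsAugmented]

/-- The points of the group of formal series as algebra morphisms. -/
noncomputable def pointsEquiv (R : Type v) [CommRing R] [Algebra ℚ R] :
    (WithConv (P.CoordAlg →ₐ[ℚ] R))ᵐᵒᵖ ≃* P.GroupPts R where
  toFun φ := ⟨fun α => φ.unop.ofConv (G α), by
    beta_reduce
    rw [G_one, map_one]⟩
  invFun g := .op (.toConv (coordLift g))
  left_inv φ := MulOpposite.unop_injective (WithConv.ofConv_injective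
    (coordAlg_hom_ext fun α => coordLift_G _ α))
  right_inv g := Subtype.ext (funext fun α => coordLift_G g α)
  map_mul' φ ψ := by
    refine Subtype.ext (funext fun α => ?_)
    -- The left convolution factor is evaluated on the inner series, hence the opposite group.
    change (ψ.unop * φ.unop) (G α) = _
    rw [AlgHom.convMul_apply]
    refine (map_coordComul_G _ α).trans ?_
    simp only [Algebra.TensorProduct.lift_tmul, map_one, one_mul, mul_one]
    rfl

variable [hS : Fact (IsHereditary P.intervalClasses)]

/-- The morphism of Hopf algebras `ρ`. -/
noncomputable def rho (hP : P.IsBasic) : P.CoordAlg →ₐc[ℚ] P.IncAlg :=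
  BialgHom.ofAlgHom (rhoAlg P) counit_rhoAlg (comul_rhoAlg hP)

/-- The morphism from the points of the incidence Hopf algebra to the group of formal series. -/
noncomputable def incPoints (hP : P.IsBasic) (R : Type v) [CommRing R] [Algebra ℚ R] :
    (WithConv (P.IncAlg →ₐ[ℚ] R))ᵐᵒᵖ →* P.GroupPts R where
  toFun φ := pointsEquiv R (.op (.toConv (φ.unop.ofConv.comp
    (rho hP : P.CoordAlg →ₐ[ℚ] P.IncAlg))))
  map_one' := by
    rw [← map_one (pointsEquiv (P := P) R)]
    refine congrArg (fun φ => pointsEquiv R (.op φ)) (WithConv.ofConv_injective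
      (AlgHom.ext fun a => ?_))
    exact congrArg (algebraMap ℚ R) (CoalgHomClass.counit_comp_apply (rho hP) a)
  map_mul' φ ψ := by
    rw [← map_mul]
    exact congrArg (fun φ => pointsEquiv R (.op φ)) (WithConv.ofConv_injective
      (AlgHom.convMul_comp_bialgHom_distrib ψ.unop φ.unop (rho hP)))

/-- Precomposition with the surjection $\rho$ is injective. -/
theorem incPoints_injective (hP : P.IsBasic) (R : Type v) [CommRing R] [Algebra ℚ R] :
    Function.Injective (incPoints hP R) := fun φ ψ h => by
  have h1 := WithConv.toConv_injective (MulOpposite.op_injective ((pointsEquiv R).injective h))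
  refine MulOpposite.unop_injective (WithConv.ofConv_injective (AlgHom.ext fun b => ?_))
  obtain ⟨a, rfl⟩ := rhoAlg_surjective b
  exact DFunLike.congr_fun h1 a

/-- The subgroup of the group of formal series defined by the incidence Hopf algebra. -/
noncomputable def incSubgroup (hP : P.IsBasic) (R : Type v) [CommRing R] [Algebra ℚ R] :
    Subgroup (P.GroupPts R) := (incPoints hP R).range

/-- The points of the incidence Hopf algebra as a subgroup of the group of formal series. -/
noncomputable def incPointsEquiv (hP : P.IsBasic) (R : Type v) [CommRing R] [Algebra ℚ R] :
    (WithConv (P.IncAlg →ₐ[ℚ] R))ᵐᵒᵖ ≃* incSubgroup hP R :=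
  MonoidHom.ofInjective (incPoints_injective hP R)

end Points

end SetOperad

theorem mainTheorem1 (P : SetOperad.{u}) [P.IsAugmented] (hbasic : P.IsBasic)
    (hfin : ∀ α : P.Coinv, Finite α.Interval) :
    ∃ (hS : IsHereditary P.intervalClasses)
      (_ : HopfAlgebra ℚ P.CoordAlg) (_ : HopfAlgebra ℚ P.IncAlg),
      P.IsCoordHopf ∧ IsIncidenceHopf hS ∧
      ∃ ρ : P.CoordAlg →ₐc[ℚ] P.IncAlg,
        (∀ α : P.Coinv, ρ (SetOperad.G α) = (α.cardAut : ℚ)⁻¹ • SetOperad.F α) ∧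
        (∀ a, ρ (HopfAlgebra.antipode ℚ a) = HopfAlgebra.antipode ℚ (ρ a)) ∧
        Function.Surjective ρ ∧
        ∀ (R : Type v) [CommRing R] [Algebra ℚ R],
          ∃ (_ : Group (P.GroupPts R)),
            (∀ (g h : P.GroupPts R) (α : P.Coinv),
              (g * h).1 α = SetOperad.mulCoeff g.1 h.1 α) ∧
            (∃ e : (WithConv (P.CoordAlg →ₐ[ℚ] R))ᵐᵒᵖ ≃* P.GroupPts R,
              ∀ φ α, (e (MulOpposite.op φ)).1 α = φ.ofConv (SetOperad.G α)) ∧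
            ∃ (K : Subgroup (P.GroupPts R))
              (e : (WithConv (P.IncAlg →ₐ[ℚ] R))ᵐᵒᵖ ≃* K),
              ∀ φ α, (e (MulOpposite.op φ)).1.1 α = φ.ofConv (ρ (SetOperad.G α)) := by
  have hS := SetOperad.isHereditary_intervalClasses hbasic hfin
  have hS' : Fact (IsHereditary P.intervalClasses) := ⟨hS⟩
  have hT : ∀ α : P.Coinv, Finite (SetOperad.TreeOf α) := fun α =>
    have := hfin α
    SetOperad.finite_treeOf hbasic α
  refine ⟨hS, SetOperad.coordHopf P, IncidenceAlg.hopfOfFact P.intervalClasses,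
    SetOperad.isCoordHopf, IncidenceAlg.isIncidenceHopf hS, SetOperad.rho hbasic,
    SetOperad.rhoAlg_G, fun a => ?_, SetOperad.rhoAlg_surjective, fun R _ _ =>
    ⟨SetOperad.groupPts P R, fun _ _ _ => rfl,
      ⟨SetOperad.pointsEquiv R, fun _ _ => rfl⟩, ?_⟩⟩
  · let _ := SetOperad.coordHopf P
    let _ := IncidenceAlg.hopfOfFact P.intervalClasses
    exact BialgHom.map_antipode (SetOperad.rho hbasic) a
  · let _ := SetOperad.groupPts P R
    let _ := SetOperad.coordHopf P
    let _ := IncidenceAlg.hopfOfFact P.intervalClasses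
    exact ⟨SetOperad.incSubgroup hbasic R, SetOperad.incPointsEquiv hbasic R, fun _ _ => rfl⟩
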